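/- Let $n\in\mathbb{N}$ and $T>0$, let $|\cdot|$ be the Euclidean norm on $\mathbb{R}^n$, and let $F:[0,T]\times\mathbb{R}^n\rightrightarrows\mathbb{R}^n$ be a set-valued mapping. Write $\operatorname{dom}F(t,\cdot)=\{x : F(t,x)\neq\emptyset\}$ and $\operatorname{graph}F(t,\cdot)=\{(x,y) : y\in F(t,x)\}$. Suppose that: (A1) For each $t\in[0,T]$, the operator $F(t,\cdot)$ is maximal monotone, that is, $\langle x_1-x_2,\,y_1-y_2\rangle\ge 0$ whenever $y_i\in F(t,x_i)$ for $i=1,2$, and its graph is not properly contained in the graph of another operator with this property. (A2) There is a nondecreasing absolutely continuous function $\varphi:[0,T]\to\mathbb{R}$ such that $$\sup_{z\in\operatorname{dom}F(s,\cdot)}\operatorname{dist}\big(z,\operatorname{dom}F(t,\cdot)\big)\le\varphi(t)-\varphi(s)\qquad\text{for all } 0\le s\le t\le T.$$ (A3) For every $r>0$ there is an integrable function $\sigma_r:[0,T]\to[0,\infty)$ such that $$|F^0(t,x)|\le\sigma_r(t)\,(1+|x|)\qquad\text{for all } t\in[0,T]\text{ and all } x\in\operatorname{dom}F(t,\cdot)\text{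 with } |x|\le r,$$ where $F^0(t,x)$ denotes the element of least norm of the (closed convex) set $F(t,x)$. (A4) The set-valued mapping $t\mapsto\operatorname{graph}F(t,\cdot)$ is outer semicontinuous on $[0,T]$: if $t_\ell\in[0,T]$, $y_\ell\in F(t_\ell,x_\ell)$ and $(t_\ell,x_\ell,y_\ell)\to(t,x,y)$, then $y\in F(t,x)$. Let $u\in L_1([0,T],\mathbb{R}^n)$. Then for every $x_0\in\operatorname{cl}\big(\operatorname{dom}F(0,\cdot)\big)$ there exists a unique absolutely continuous function $x:[0,T]\to\mathbb{R}^n$ such that $x(0)=x_0$ and, for almost every $t\in[0,T]$, $x(t)\in\operatorname{dom}F(t,\cdot)$, $x$ is differentiable at $t$, and $$\dot x(t)\in-F\big(t,x(t)\big)+u(t).$$ -/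

import Mathlib

open Set Filter Topology MeasureTheory
open scoped ENNReal

namespace EvolInclusion

section SetValued

variable {E : Type*} [NormedAddCommGroup E] [InnerProductSpace ℝ E]

/-- The domain of a set-valued mapping. -/
def dom (A : E → Set E) : Set E := {x | (A x).Nonempty}

/-- The graph of a set-valued mapping. -/
def graph (A : E → Set E) : Set (E × E) := {p | p.2 ∈ A p.1}

/-- A monotone set-valued mapping. -/
def IsMonotone (A : E → Set E) : Prop :=
  ∀ x₁ x₂ y₁ y₂ : E, y₁ ∈ A x₁ → y₂ ∈ A x₂ → 0 ≤ inner ℝ (x₁ - x₂) (y₁ - y₂)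

/-- A maximal monotone set-valued mapping: monotone, and its graph has no proper monotone
enlargement. -/
def IsMaximalMonotone (A : E → Set E) : Prop :=
  IsMonotone A ∧ ∀ B : E → Set E, IsMonotone B → graph A ⊆ graph B → graph B = graph A

/-- The projection of `x` onto `S`: a point of `S` whose distance to `x` is `dist(x, S)`.
It exists and is unique if `S` is nonempty, closed and convex (in finite dimension); it is
used only for such sets. -/
noncomputable def proj (x : E) (S : Set E) : E :=
  Classical.epsilon fun y => y ∈ S ∧ dist x y = Metric.infDist x S

/-- The minimal section `A⁰(x) = proj(0, A(x))`. -/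
noncomputable def minimalSection (A : E → Set E) (x : E) : E := proj 0 (A x)

end SetValued

section SetLimits

variable {Y : Type*} [TopologicalSpace Y]

/-- The outer limit of a sequence of sets: the limits of convergent selections along
subsequences. -/
def outerLimit (S : ℕ → Set Y) : Set Y :=
  {ξ | ∃ N : ℕ → ℕ, StrictMono N ∧ ∃ s : ℕ → Y, (∀ k, s k ∈ S (N k)) ∧ Tendsto s atTop (𝓝 ξ)}

/-- The outer limit of `G` at `a`, for `G` regarded as a set-valued mapping on `I`: the union
of the outer limits of `G (t ℓ)` over all sequences `t` in `I` that converge to `a`. -/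
def outerLimitAt (G : ℝ → Set Y) (I : Set ℝ) (a : ℝ) : Set Y :=
  {y | ∃ t : ℕ → ℝ, (∀ l, t l ∈ I) ∧ Tendsto t atTop (𝓝 a) ∧ y ∈ outerLimit fun l => G (t l)}

/-- Outer semicontinuity on `I` of a set-valued mapping defined on `I`. -/
def OuterSemicontinuousOn (G : ℝ → Set Y) (I : Set ℝ) : Prop :=
  ∀ a ∈ I, outerLimitAt G I a ⊆ G a

end SetLimits

section Inclusion

variable {E : Type*} [NormedAddCommGroup E] [InnerProductSpace ℝ E]

/-- The excess `sup_{z ∈ dom F(s,·)} dist(z, dom F(t,·))` is at most `φ(t) - φ(s)` for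
`0 ≤ s ≤ t ≤ T`, with `φ` nondecreasing and absolutely continuous. The supremum and the
distance are taken in `[0, ∞]`. -/
def DomainsMoveAbsCont (T : ℝ) (F : ℝ → E → Set E) : Prop :=
  ∃ φ : ℝ → ℝ, MonotoneOn φ (Icc 0 T) ∧ AbsolutelyContinuousOnInterval φ 0 T ∧
    ∀ s t : ℝ, 0 ≤ s → s ≤ t → t ≤ T →
      ⨆ z ∈ dom (F s), Metric.infEDist z (dom (F t)) ≤ ENNReal.ofReal (φ t - φ s)

/-- For every `r > 0` there is a nonnegative integrable `σ` on `[0,T]` with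
`|F⁰(t,x)| ≤ σ(t) (1 + |x|)` for all `t ∈ [0,T]` and all `x ∈ dom F(t,·)` with `|x| ≤ r`. -/
def MinimalSectionGrowth (T : ℝ) (F : ℝ → E → Set E) : Prop :=
  ∀ r : ℝ, 0 < r → ∃ σ : ℝ → ℝ, IntegrableOn σ (Icc 0 T) ∧ (∀ t ∈ Icc 0 T, 0 ≤ σ t) ∧
    ∀ t ∈ Icc 0 T, ∀ x ∈ Metric.closedBall (0 : E) r ∩ dom (F t),
      ‖minimalSection (F t) x‖ ≤ σ t * (1 + ‖x‖)

/-- `x` is an absolutely continuous solution on `[0,T]` of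
`x'(t) ∈ -F(t, x(t)) + u(t)`, `x(0) = x₀`; the inclusion holds for almost every `t`. -/
def IsSolution (T : ℝ) (F : ℝ → E → Set E) (u : ℝ → E) (x₀ : E) (x : ℝ → E) : Prop :=
  AbsolutelyContinuousOnInterval x 0 T ∧ x 0 = x₀ ∧
    ∀ᵐ t ∂(volume.restrict (Icc 0 T)), x t ∈ dom (F t) ∧
      ∃ v : E, HasDerivAt x v t ∧ ∃ w ∈ F t (x t), v = -w + u t

end Inclusion

end EvolInclusion

/-! Uniqueness: by monotonicity the squared distance between two solutions has nonpositive
derivative almost everywhere.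

Existence: replace `F t` by its Yosida approximation with the time-dependent parameter `ε / g t`,
where `g` is integrable and dominates `‖u‖`, the speed of the domains and a bound for a selection of
`F t` on a ball. The equation is then Lipschitz in space with an integrable constant
(`exists_caratheodory_solution`). Its trajectory is pulled to `dom (F t)` at rate `g t / ε`, fast
enough to stay within `ε` of it (`infDist_le_of_relaxation`). Hence the resolvent moves `x t` by at
most `3 * ε`, and the Yosida term is at most `3 * g t`, uniformly in `ε`. Monotonicity makes these
trajectories Cauchy (`IsApproxSolution.norm_sub_sq_le`), and maximality identifies the derivative of
the limit (`exists_solution_of_approx`).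

One circularity has to be broken: `g` depends on the radius of a ball containing the trajectories,
which in turn depend on `g`. The radius comes from comparison with a curve following the domains at
a speed that depends on `φ` alone (`exists_domain_tracking`, `norm_yosida_sub_le`).

Resolvents exist by Minty's theorem, derived from a minimax argument. Their limits as the parameter
tends to `0` are projections onto the domain, which gives convexity of the domains and measurability
of the projections in time. -/

namespace EvolInclusion

/-! ### Maximal monotone operators: Minty's theorem, resolvents, closed convex domains. -/

section Resolvent

variable {E : Type*} [NormedAddCommGroup E] [InnerProductSpace ℝ E]

theorem convexOn_inner_sub_sub (a b : E) :
    ConvexOn ℝ univ fun x : E => inner ℝ (x - a) (x - b) := by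
  refine ⟨convex_univ, fun x _ y _ s t hs ht hst => ?_⟩
  have key : s • inner ℝ (x - a) (x - b) + t • inner ℝ (y - a) (y - b) -
      inner ℝ (s • x + t • y - a) (s • x + t • y - b) = s * t * inner ℝ (x - y) (x - y) := by
    obtain rfl : t = 1 - s := by linarith
    simp only [inner_sub_left, inner_sub_right, inner_add_left, inner_add_right,
      real_inner_smul_left, real_inner_smul_right, smul_eq_mul, real_inner_comm x y]
    ring
  have : 0 ≤ s * t * inner ℝ (x - y) (x - y) :=
    mul_nonneg (mul_nonneg hs ht) real_inner_self_nonneg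
  linarith

/-- At the barycentre `x`, the terms `p i * ⟪x, x - y i⟫` cancel; symmetrising the remaining double
sum in `i` and `j` leaves only the products controlled by `h`. -/
theorem sum_mul_inner_sub_nonpos {ι : Type*} [Fintype ι] (y b : ι → E)
    (h : ∀ i j, inner ℝ (y i - y j) (b i - b j) ≤ 0) {p : ι → ℝ} (hp : p ∈ stdSimplex ℝ ι) :
    ∑ i, p i * inner ℝ ((∑ j, p j • y j) - b i) ((∑ j, p j • y j) - y i) ≤ 0 := by
  set x := ∑ j, p j • y j with hx
  have h1 : ∑ i, p i * inner ℝ x (x - y i) = 0 := by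
    have : ∑ i, p i * inner ℝ x (x - y i) = inner ℝ x (∑ i, p i • (x - y i)) := by
      simp [inner_sum, real_inner_smul_right]
    rw [this]
    simp [smul_sub, Finset.sum_sub_distrib, ← Finset.sum_smul, hp.2, hx]
  have h2 : ∑ i, p i * inner ℝ (b i) (x - y i) =
      ∑ i, ∑ j, p i * p j * inner ℝ (b i) (y j - y i) := by
    refine Finset.sum_congr rfl fun i _ => ?_
    have : x - y i = ∑ j, p j • (y j - y i) := by
      simp [smul_sub, Finset.sum_sub_distrib, ← Finset.sum_smul, hp.2, hx]
    rw [this, inner_sum, Finset.mul_sum]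
    simp [real_inner_smul_right, mul_assoc]
  have h3 : 2 * ∑ i, ∑ j, p i * p j * inner ℝ (b i) (y j - y i) =
      ∑ i, ∑ j, p i * p j * -inner ℝ (y i - y j) (b i - b j) := by
    have h4 : ∑ i, ∑ j, p i * p j * inner ℝ (b i) (y j - y i) =
      ∑ i, ∑ j, p i * p j * inner ℝ (b j) (y i - y j) := by
      rw [Finset.sum_comm]
      simp only [mul_comm]
    rw [two_mul]
    nth_rw 2 [h4]
    simp only [← Finset.sum_add_distrib, ← mul_add]
    refine Finset.sum_congr rfl fun i _ => Finset.sum_congr rfl fun j _ => ?_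
    simp only [inner_sub_left, inner_sub_right, real_inner_comm]
    ring
  have h5 : 0 ≤ ∑ i, ∑ j, p i * p j * -inner ℝ (y i - y j) (b i - b j) :=
    Finset.sum_nonneg fun i _ => Finset.sum_nonneg fun j _ =>
      mul_nonneg (mul_nonneg (hp.1 i) (hp.1 j)) (by linarith [h i j])
  simp only [inner_sub_left _ (b _), mul_sub, Finset.sum_sub_distrib]
  linarith

/-- A Debrunner–Flor lemma. If every `x` violated some inequality, Sion's minimax theorem would give
one weight vector `p` whose weighted sum is positive on the whole convex hull of the `y i`,
contradicting `sum_mul_inner_sub_nonpos` at the barycentre for `p`. -/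
theorem exists_forall_inner_sub_nonpos {ι : Type*} [Fintype ι] [Nonempty ι] (y b : ι → E)
    (h : ∀ i j, inner ℝ (y i - y j) (b i - b j) ≤ 0) :
    ∃ x : E, ∀ i, inner ℝ (x - b i) (x - y i) ≤ 0 := by
  classical
  by_contra! hcon
  let f : E → (ι → ℝ) → ℝ := fun x p => ∑ i, p i * inner ℝ (x - b i) (x - y i)
  have hconv : ∀ p ∈ stdSimplex ℝ ι, ConvexOn ℝ (convexHull ℝ (range y)) fun x => f x p := by
    intro p hp
    refine ConvexOn.subset ?_ (subset_univ _) (convex_convexHull ℝ _)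
    have : (fun x => f x p) = ∑ i, fun x => p i • inner ℝ (x - b i) (x - y i) := by
      ext x
      simp [f]
    rw [this]
    refine Finset.sum_induction _ (ConvexOn ℝ univ) (fun _ _ => ConvexOn.add)
      (convexOn_const 0 convex_univ) fun i _ => (convexOn_inner_sub_sub (b i) (y i)).smul (hp.1 i)
  obtain ⟨p, hp, hlt⟩ := Sion.exists_lt_iInf_of_lt_iInf_of_finite
    (X := convexHull ℝ (range y)) (Y := stdSimplex ℝ ι) (f := f) (t := 0)
    (s := range fun i => Pi.single i 1)
    (by simp [range_nonempty])
    ((finite_range y).isCompact_convexHull ℝ)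
    (fun p _ => ContinuousOn.lowerSemicontinuousOn (by fun_prop))
    (fun p hp => (hconv p hp).quasiconvexOn)
    (convex_stdSimplex ℝ ι)
    (fun x _ => ContinuousOn.upperSemicontinuousOn (by fun_prop))
    (fun x _ => ConcaveOn.quasiconcaveOn ⟨convex_stdSimplex ℝ ι, fun p _ q _ s t _ _ _ => by
      simp [f, add_mul, Finset.sum_add_distrib, Finset.mul_sum, mul_assoc]⟩)
    (convex_convexHull ℝ _)
    (finite_range _)
    (by rintro _ ⟨i, rfl⟩; exact single_mem_stdSimplex ℝ i)
    (fun x _ => by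
      obtain ⟨i, hi⟩ := hcon x
      exact ⟨_, ⟨i, rfl⟩, by simpa [f, Pi.single_apply] using hi⟩)
  refine (sum_mul_inner_sub_nonpos y b h hp).not_gt (hlt _ ?_)
  exact (convex_convexHull ℝ _).sum_mem (fun i _ => hp.1 i) hp.2
    fun i _ => subset_convexHull ℝ _ (mem_range_self i)

variable {A : E → Set E}

theorem IsMaximalMonotone.mem_of_forall (hA : IsMaximalMonotone A) {x y : E}
    (h : ∀ z v, v ∈ A z → 0 ≤ inner ℝ (x - z) (y - v)) : y ∈ A x := by
  let B : E → Set E := fun z => {v | v ∈ A z ∨ (z = x ∧ v = y)}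
  have hB : IsMonotone B := by
    rintro x₁ x₂ y₁ y₂ (h₁ | ⟨rfl, rfl⟩) (h₂ | ⟨rfl, rfl⟩)
    · exact hA.1 _ _ _ _ h₁ h₂
    · have := h _ _ h₁
      rwa [← neg_sub x₁, ← neg_sub y₁, inner_neg_neg] at this
    · exact h _ _ h₂
    · simp
  have := hA.2 B hB fun p hp => Or.inl hp
  have hxy : ((x, y) : E × E) ∈ graph B := Or.inr ⟨rfl, rfl⟩
  rw [this] at hxy
  exact hxy

theorem IsMaximalMonotone.isClosed_values (hA : IsMaximalMonotone A) (x : E) :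
    IsClosed (A x) := by
  have : A x = ⋂ (z) (v) (_ : v ∈ A z), {y | 0 ≤ inner ℝ (x - z) (y - v)} := by
    ext y
    simp only [mem_iInter]
    exact ⟨fun hy z v hv => hA.1 _ _ _ _ hy hv, hA.mem_of_forall⟩
  rw [this]
  refine isClosed_iInter fun z => isClosed_iInter fun v => isClosed_iInter fun _ => ?_
  exact isClosed_le continuous_const (by fun_prop)

theorem IsMaximalMonotone.mem_of_tendsto (hA : IsMaximalMonotone A) {x y : ℕ → E} {a b : E}
    (h : ∀ n, y n ∈ A (x n)) (hx : Tendsto x atTop (𝓝 a)) (hy : Tendsto y atTop (𝓝 b)) :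
    b ∈ A a :=
  hA.mem_of_forall fun _ _ hv =>
    ge_of_tendsto' ((hx.sub tendsto_const_nhds).inner (hy.sub tendsto_const_nhds))
      fun n => hA.1 _ _ _ _ (h n) hv

theorem IsMonotone.norm_sub_le_of_smul_mem (hA : IsMonotone A) {c : ℝ} (hc : 0 < c) {x y z w : E}
    (hz : c⁻¹ • (x - z) ∈ A z) (hw : c⁻¹ • (y - w) ∈ A w) : ‖z - w‖ ≤ ‖x - y‖ := by
  have h := hA _ _ _ _ hz hw
  rw [← smul_sub, real_inner_smul_right] at h
  have h1 : 0 ≤ inner ℝ (z - w) (x - z - (y - w)) :=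
    nonneg_of_mul_nonneg_right h (inv_pos.2 hc)
  have h2 : x - z - (y - w) = (x - y) - (z - w) := by abel
  rw [h2, inner_sub_right, real_inner_self_eq_norm_sq] at h1
  have h3 := real_inner_le_norm (z - w) (x - y)
  by_contra! hlt
  nlinarith [norm_nonneg (x - y)]

variable [FiniteDimensional ℝ E]

/-- Minty's theorem: `I + c A` is onto for maximal monotone `A` and `c > 0`. -/
theorem IsMaximalMonotone.exists_resolvent (hA : IsMaximalMonotone A) {c : ℝ} (hc : 0 < c)
    (x : E) : ∃ z, c⁻¹ • (x - z) ∈ A z := by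
  -- `K (y, v)` is the ball with diameter from `y` to `x - c • v`. A point common to all of them is
  -- monotonically related to the whole graph; compactness reduces the matter to finitely many
  -- balls.
  let K : graph A → Set E := fun q => {z | inner ℝ (z - (x - c • q.1.2)) (z - q.1.1) ≤ 0}
  have hcl : ∀ q, IsClosed (K q) := fun q => isClosed_le (by fun_prop) continuous_const
  suffices h : (⋂ q, K q).Nonempty by
    obtain ⟨z, hz⟩ := h
    refine ⟨z, hA.mem_of_forall fun y v hv => ?_⟩
    have h1 : inner ℝ (z - (x - c • v)) (z - y) ≤ 0 := mem_iInter.1 hz ⟨(y, v), hv⟩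
    have h2 : c⁻¹ • (x - z) - v = -(c⁻¹ • (z - (x - c • v))) := by
      have : v = c⁻¹ • c • v := by rw [smul_smul, inv_mul_cancel₀ hc.ne', one_smul]
      nth_rw 1 [this]
      module
    rw [h2, inner_neg_right, real_inner_smul_right, real_inner_comm]
    have := mul_nonneg (inv_pos.2 hc).le (neg_nonneg.2 h1)
    linarith
  rcases isEmpty_or_nonempty (graph A) with hem | ⟨⟨q₀⟩⟩
  · simp
  have hfin : ∀ t : Finset (graph A), (K q₀ ∩ ⋂ q ∈ t, K q).Nonempty := by
    intro t
    classical
    have : Nonempty (insert q₀ t : Finset (graph A)) := ⟨q₀, by simp⟩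
    obtain ⟨z, hz⟩ := exists_forall_inner_sub_nonpos
      (ι := (insert q₀ t : Finset (graph A))) (fun q => q.1.1.1) (fun q => x - c • q.1.1.2)
      (fun i j => by
        have := hA.1 _ _ _ _ i.1.2 j.1.2
        rw [sub_sub_sub_cancel_left, ← smul_sub, real_inner_smul_right, ← neg_sub i.1.1.2,
          inner_neg_right]
        have := mul_nonneg hc.le this
        linarith)
    refine ⟨z, hz ⟨q₀, by simp⟩, mem_iInter₂.2 fun q hq => hz ⟨q, by simp [hq]⟩⟩
  refine (IsCompact.inter_iInter_nonempty ?_ K hcl hfin).mono inter_subset_right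
  refine Metric.isCompact_of_isClosed_isBounded (hcl q₀) ?_
  refine (Metric.isBounded_closedBall (x := q₀.1.1)
    (r := ‖q₀.1.1 - (x - c • q₀.1.2)‖)).subset fun z hz => ?_
  have hz' : inner ℝ (z - (x - c • q₀.1.2)) (z - q₀.1.1) ≤ 0 := hz
  rw [mem_closedBall_iff_norm]
  have h1 : ‖z - q₀.1.1‖ ^ 2 ≤ -inner ℝ (q₀.1.1 - (x - c • q₀.1.2)) (z - q₀.1.1) := by
    rw [← real_inner_self_eq_norm_sq]
    have : inner ℝ (z - (x - c • q₀.1.2)) (z - q₀.1.1) = inner ℝ (z - q₀.1.1) (z - q₀.1.1) +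
        inner ℝ (q₀.1.1 - (x - c • q₀.1.2)) (z - q₀.1.1) := by
      rw [← inner_add_left]; congr 1; abel
    linarith
  have h2 := abs_real_inner_le_norm (q₀.1.1 - (x - c • q₀.1.2)) (z - q₀.1.1)
  have h3 := neg_abs_le (inner ℝ (q₀.1.1 - (x - c • q₀.1.2)) (z - q₀.1.1))
  by_contra! hlt
  nlinarith [norm_nonneg (q₀.1.1 - (x - c • q₀.1.2))]

/-- The resolvent `(I + c A)⁻¹ x`. -/
noncomputable def resolvent (A : E → Set E) (c : ℝ) (x : E) : E :=
  Classical.epsilon fun z => c⁻¹ • (x - z) ∈ A z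

theorem IsMaximalMonotone.resolvent_spec (hA : IsMaximalMonotone A) {c : ℝ} (hc : 0 < c)
    (x : E) : c⁻¹ • (x - resolvent A c x) ∈ A (resolvent A c x) :=
  Classical.epsilon_spec (hA.exists_resolvent hc x)

theorem IsMaximalMonotone.resolvent_mem_dom (hA : IsMaximalMonotone A) {c : ℝ} (hc : 0 < c)
    (x : E) : resolvent A c x ∈ dom A :=
  ⟨_, hA.resolvent_spec hc x⟩

theorem IsMaximalMonotone.dom_nonempty (hA : IsMaximalMonotone A) : (dom A).Nonempty :=
  ⟨_, hA.resolvent_mem_dom one_pos 0⟩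

theorem IsMaximalMonotone.norm_resolvent_sub_le (hA : IsMaximalMonotone A) {c : ℝ} (hc : 0 < c)
    (x y : E) : ‖resolvent A c x - resolvent A c y‖ ≤ ‖x - y‖ :=
  hA.1.norm_sub_le_of_smul_mem hc (hA.resolvent_spec hc x) (hA.resolvent_spec hc y)

theorem IsMaximalMonotone.eq_resolvent (hA : IsMaximalMonotone A) {c : ℝ} (hc : 0 < c) {x z : E}
    (hz : c⁻¹ • (x - z) ∈ A z) : z = resolvent A c x := by
  have := hA.1.norm_sub_le_of_smul_mem hc hz (hA.resolvent_spec hc x)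
  rw [sub_self, norm_zero] at this
  exact sub_eq_zero.1 (norm_le_zero_iff.1 this)

/-- The point `z` is the resolvent of `z + c • v`, so nonexpansiveness compares the resolvent of `x`
with `z`. -/
theorem IsMaximalMonotone.norm_resolvent_sub_self_le (hA : IsMaximalMonotone A) {c : ℝ}
    (hc : 0 < c) (x : E) {z v : E} (hv : v ∈ A z) :
    ‖resolvent A c x - x‖ ≤ c * ‖v‖ + 2 * ‖x - z‖ := by
  have h : c⁻¹ • ((z + c • v) - z) ∈ A z := by
    rwa [add_sub_cancel_left, smul_smul, inv_mul_cancel₀ hc.ne', one_smul]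
  have h1 := hA.1.norm_sub_le_of_smul_mem hc (hA.resolvent_spec hc x) h
  have h2 : ‖x - (z + c • v)‖ ≤ ‖x - z‖ + c * ‖v‖ := by
    rw [← sub_sub]
    refine (norm_sub_le _ _).trans ?_
    rw [norm_smul, Real.norm_of_nonneg hc.le]
  have h3 : ‖resolvent A c x - x‖ ≤ ‖resolvent A c x - z‖ + ‖x - z‖ := by
    rw [norm_sub_rev x z]
    exact norm_sub_le_norm_sub_add_norm_sub _ _ _
  linarith

theorem IsMaximalMonotone.minimalSection_mem (hA : IsMaximalMonotone A) {x : E}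
    (hx : x ∈ dom A) : minimalSection A x ∈ A x := by
  obtain ⟨y, hy, h⟩ := (hA.isClosed_values x).exists_infDist_eq_dist hx 0
  exact (Classical.epsilon_spec (p := fun y => y ∈ A x ∧ dist 0 y = Metric.infDist 0 (A x))
    ⟨y, hy, h.symm⟩).1

/-- If `A` has a locally bounded selection, then its domain is closed. -/
theorem IsMaximalMonotone.isClosed_dom (hA : IsMaximalMonotone A)
    (h : ∀ r : ℝ, 0 < r → ∃ c, ∀ x ∈ dom A, ‖x‖ ≤ r → ∃ v ∈ A x, ‖v‖ ≤ c) :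
    IsClosed (dom A) := by
  refine isClosed_of_closure_subset fun a ha => ?_
  obtain ⟨x, hx, hxa⟩ := mem_closure_iff_seq_limit.1 ha
  obtain ⟨r, hr0, hr⟩ := (Metric.isBounded_range_of_tendsto x hxa).exists_pos_norm_le
  obtain ⟨c, hc⟩ := h r hr0
  choose v hv hvc using fun n => hc (x n) (hx n) (hr _ (mem_range_self n))
  obtain ⟨b, _, θ, hθ, hb⟩ := (isCompact_closedBall (0 : E) c).tendsto_subseq
    (fun n => mem_closedBall_zero_iff.2 (hvc n))
  exact ⟨b, hA.mem_of_tendsto (fun n => hv (θ n)) (hxa.comp hθ.tendsto_atTop) hb⟩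

/-- As `c → 0`, resolvents converge to the nearest point of the closed convex hull of the
domain. -/
theorem IsMaximalMonotone.exists_tendsto_resolvent (hA : IsMaximalMonotone A) (x : E)
    {c : ℕ → ℝ} (hc : ∀ n, 0 < c n) (hc0 : Tendsto c atTop (𝓝 0)) :
    ∃ p ∈ closure (dom A), Tendsto (fun n => resolvent A (c n) x) atTop (𝓝 p) ∧
      ∀ y ∈ closure (convexHull ℝ (dom A)), inner ℝ (x - p) (y - p) ≤ 0 := by
  set D := closure (convexHull ℝ (dom A)) with hD
  have hDc : Convex ℝ D := (convex_convexHull ℝ _).closure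
  have hsub : dom A ⊆ D := (subset_convexHull ℝ _).trans subset_closure
  obtain ⟨p, hpD, hp⟩ := exists_norm_eq_iInf_of_complete_convex (hA.dom_nonempty.mono hsub)
    isClosed_closure.isComplete hDc x
  rw [norm_eq_iInf_iff_real_inner_le_zero hDc hpD] at hp
  set J : ℕ → E := fun n => resolvent A (c n) x with hJ
  obtain ⟨z, v, hv⟩ := hA.dom_nonempty
  have hcb : ∀ᶠ n in atTop, c n ≤ 1 := (hc0.eventually (ge_mem_nhds one_pos))
  set B := ‖v‖ + 2 * ‖x - z‖ with hB
  have hbd : ∀ᶠ n in atTop, ‖J n - x‖ ≤ B := by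
    filter_upwards [hcb] with n hn
    refine (hA.norm_resolvent_sub_self_le (hc n) x hv).trans ?_
    have := mul_le_mul_of_nonneg_right hn (norm_nonneg v)
    linarith
  have hB0 : 0 ≤ B := by positivity
  -- The condition says `limsup ⟪J n - y, J n - x⟫ ≤ 0`. It holds on the domain by monotonicity and
  -- survives convex combinations and closure, so it reaches the projection `p`, where it forces `J
  -- n → p`.
  let S : Set E := {y | ∀ ε : ℝ, 0 < ε → ∀ᶠ n in atTop, inner ℝ (J n - y) (J n - x) ≤ ε}
  have hSdom : dom A ⊆ S := by
    rintro y ⟨w, hw⟩ ε hε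
    have hlim : Tendsto (fun n => c n * (‖w‖ * (‖y - x‖ + B))) atTop (𝓝 0) := by
      simpa using hc0.mul_const (‖w‖ * (‖y - x‖ + B))
    filter_upwards [hbd, hlim.eventually (ge_mem_nhds hε)] with n hn hn'
    have h := hA.1 _ _ _ _ (hA.resolvent_spec (hc n) x) hw
    have e : (c n)⁻¹ • (x - J n) - w = (c n)⁻¹ • ((x - J n) - c n • w) := by
      rw [smul_sub (c n)⁻¹ (x - J n), smul_smul, inv_mul_cancel₀ (hc n).ne', one_smul]
    rw [e, real_inner_smul_right] at h
    have h1 : 0 ≤ inner ℝ (J n - y) ((x - J n) - c n • w) :=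
      nonneg_of_mul_nonneg_right h (inv_pos.2 (hc n))
    rw [inner_sub_right, real_inner_smul_right, ← neg_sub (J n) x, inner_neg_right] at h1
    have h2 : -inner ℝ (J n - y) w ≤ ‖w‖ * (‖y - x‖ + B) := by
      have h3 := neg_abs_le (inner ℝ (J n - y) w)
      have h4 := abs_real_inner_le_norm (J n - y) w
      have h5 : ‖J n - y‖ ≤ ‖y - x‖ + B := by
        have := norm_sub_le_norm_sub_add_norm_sub (J n) x y
        rw [norm_sub_rev x y] at this
        linarith
      nlinarith [norm_nonneg w]
    have h6 := mul_le_mul_of_nonneg_left h2 (hc n).le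
    linarith
  have hSconv : Convex ℝ S := by
    intro y hy y' hy' s t hs ht hst ε hε
    filter_upwards [hy ε hε, hy' ε hε] with n h1 h2
    have : inner ℝ (J n - (s • y + t • y')) (J n - x) =
        s * inner ℝ (J n - y) (J n - x) + t * inner ℝ (J n - y') (J n - x) := by
      rw [← real_inner_smul_left, ← real_inner_smul_left, ← inner_add_left]
      congr 1
      obtain rfl : t = 1 - s := by linarith
      module
    rw [this]
    calc _ ≤ s * ε + t * ε := by gcongr
      _ = ε := by rw [← add_mul, hst, one_mul]
  have hSclosed : closure S ⊆ S := by
    intro y hy ε hε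
    obtain ⟨y', hy', hyy'⟩ := Metric.mem_closure_iff.1 hy (ε / 2 / (B + 1)) (by positivity)
    filter_upwards [hbd, hy' (ε / 2) (by positivity)] with n h1 h2
    have e : inner ℝ (J n - y) (J n - x) =
        inner ℝ (J n - y') (J n - x) + inner ℝ (y' - y) (J n - x) := by
      rw [← inner_add_left]; congr 1; abel
    have h3 := real_inner_le_norm (y' - y) (J n - x)
    rw [dist_eq_norm, norm_sub_rev, lt_div_iff₀ (by positivity)] at hyy'
    have h4 : ‖y' - y‖ * ‖J n - x‖ ≤ ‖y' - y‖ * (B + 1) := by gcongr; linarith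
    linarith
  have hpS : p ∈ S := hSclosed (closure_mono (convexHull_min hSdom hSconv) hpD)
  have hlim : Tendsto J atTop (𝓝 p) := by
    rw [Metric.tendsto_nhds]
    intro ε hε
    filter_upwards [hpS (ε ^ 2 / 2) (by positivity)] with n hn
    have h1 := hp (J n) (hsub (hA.resolvent_mem_dom (hc n) x))
    have h2 : ‖J n - p‖ ^ 2 = inner ℝ (J n - p) (J n - x) + inner ℝ (x - p) (J n - p) := by
      rw [real_inner_comm, ← inner_add_left, sub_add_sub_cancel, real_inner_self_eq_norm_sq]
    rw [dist_eq_norm]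
    refine lt_of_pow_lt_pow_left₀ 2 hε.le ?_
    have : 0 < ε ^ 2 := by positivity
    linarith
  exact ⟨p, mem_closure_of_tendsto hlim
    (Eventually.of_forall fun n => hA.resolvent_mem_dom (hc n) x), hlim, hp⟩

/-- For `x` in the closed convex hull, the variational inequality for the limit `p` of resolvents,
tested at `x` itself, gives `p = x`; and `p` lies in the closed domain. -/
theorem IsMaximalMonotone.convex_dom (hA : IsMaximalMonotone A) (hcl : IsClosed (dom A)) :
    Convex ℝ (dom A) := by
  have : dom A = closure (convexHull ℝ (dom A)) := by
    refine ((subset_convexHull ℝ _).trans subset_closure).antisymm fun x hx => ?_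
    obtain ⟨p, hp, -, h⟩ := hA.exists_tendsto_resolvent x (c := fun n : ℕ => 1 / ((n : ℝ) + 1))
      (fun n => by positivity) tendsto_one_div_add_atTop_nhds_zero_nat
    have h1 := h x hx
    rw [real_inner_self_nonpos, sub_eq_zero] at h1
    rw [h1]
    exact hcl.closure_subset hp
  rw [this]
  exact (convex_convexHull ℝ _).closure

/-- The nearest point of the domain is the limit of resolvents. -/
theorem IsMaximalMonotone.tendsto_resolvent_of_isClosed (hA : IsMaximalMonotone A)
    (hcl : IsClosed (dom A)) :
    ∃ P : E → E, (∀ x, P x ∈ dom A) ∧ (∀ x, ‖P x - x‖ = Metric.infDist x (dom A)) ∧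
      (∀ x y, ‖P x - P y‖ ≤ ‖x - y‖) ∧
      ∀ x, Tendsto (fun n : ℕ => resolvent A (1 / ((n : ℝ) + 1)) x) atTop (𝓝 (P x)) := by
  choose P hP hlim hin using fun x => hA.exists_tendsto_resolvent x
    (c := fun n : ℕ => 1 / ((n : ℝ) + 1)) (fun n => by positivity)
    tendsto_one_div_add_atTop_nhds_zero_nat
  refine ⟨P, fun x => hcl.closure_subset (hP x), fun x => ?_, fun x y => ?_, hlim⟩
  · have hmem := hcl.closure_subset (hP x)
    refine le_antisymm ?_ ?_
    · refine (Metric.le_infDist hA.dom_nonempty).2 fun y hy => ?_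
      have h1 := hin x y (subset_closure (subset_convexHull ℝ _ hy))
      rw [dist_eq_norm]
      have h2 : ‖P x - x‖ ^ 2 ≤ ‖P x - x‖ * ‖x - y‖ := by
        have h3 := real_inner_le_norm (x - P x) (x - y)
        have h4 : inner ℝ (x - P x) (x - y) =
            inner ℝ (x - P x) (x - P x) - inner ℝ (x - P x) (y - P x) := by
          rw [← inner_sub_right]; congr 1; abel
        rw [norm_sub_rev (P x) x, ← real_inner_self_eq_norm_sq]
        linarith
      by_contra! hlt
      nlinarith [norm_nonneg (x - y)]
    · rw [norm_sub_rev, ← dist_eq_norm]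
      exact Metric.infDist_le_dist_of_mem hmem
  · exact le_of_tendsto' ((hlim x).sub (hlim y)).norm
      fun n => hA.norm_resolvent_sub_le (by positivity) x y

end Resolvent

/-! ### Absolutely continuous functions and differential inequalities. -/

section AbsolutelyContinuous

theorem absolutelyContinuousOnInterval_of_dist_le {X Y : Type*} [PseudoMetricSpace X]
    [PseudoMetricSpace Y] {f : ℝ → X} {h : ℝ → Y} {a b : ℝ}
    (hh : AbsolutelyContinuousOnInterval h a b) (K : ℝ)
    (hd : ∀ s ∈ uIcc a b, ∀ t ∈ uIcc a b, dist (f s) (f t) ≤ K * dist (h s) (h t)) :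
    AbsolutelyContinuousOnInterval f a b := by
  have h0 := Tendsto.const_mul K hh
  rw [mul_zero] at h0
  refine squeeze_zero' (Eventually.of_forall fun _ => Finset.sum_nonneg fun _ _ => dist_nonneg)
    ?_ h0
  rw [eventually_inf_principal]
  filter_upwards with I hI
  rw [Finset.mul_sum]
  exact Finset.sum_le_sum fun i hi => hd _ (hI.1 i hi).1 _ (hI.1 i hi).2

theorem _root_.LipschitzWith.comp_absolutelyContinuousOnInterval {X Y : Type*}
    [PseudoMetricSpace X] [PseudoMetricSpace Y] {K : NNReal} {g : Y → X} (hg : LipschitzWith K g)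
    {f : ℝ → Y} {a b : ℝ} (hf : AbsolutelyContinuousOnInterval f a b) :
    AbsolutelyContinuousOnInterval (fun t => g (f t)) a b :=
  absolutelyContinuousOnInterval_of_dist_le hf K fun s _ t _ => hg.dist_le_mul (f s) (f t)

theorem absolutelyContinuousOnInterval_primitive {E : Type*} [NormedAddCommGroup E]
    [NormedSpace ℝ E] {f : ℝ → E} {a b : ℝ} (hf : IntervalIntegrable f volume a b) :
    AbsolutelyContinuousOnInterval (fun t => ∫ s in a..t, f s) a b := by
  refine absolutelyContinuousOnInterval_of_dist_le
    (hf.norm.absolutelyContinuousOnInterval_intervalIntegral left_mem_uIcc) 1 fun s hs t ht => ?_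
  have hi : ∀ r ∈ uIcc a b, IntervalIntegrable f volume a r := fun r hr =>
    hf.mono_set (uIcc_subset_uIcc left_mem_uIcc hr)
  rw [dist_eq_norm, Real.dist_eq, one_mul,
    intervalIntegral.integral_interval_sub_left (hi s hs) (hi t ht),
    intervalIntegral.integral_interval_sub_left (hi s hs).norm (hi t ht).norm]
  exact intervalIntegral.norm_integral_le_abs_integral_norm

theorem sub_le_integral_of_ae_deriv_le {f m : ℝ → ℝ} {a b : ℝ} (hab : a ≤ b)
    (hf : AbsolutelyContinuousOnInterval f a b) (hm : IntervalIntegrable m volume a b)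
    (h : ∀ᵐ t, t ∈ Icc a b → ∀ d, HasDerivAt f d t → d ≤ m t) :
    f b - f a ≤ ∫ t in a..b, m t := by
  rw [← hf.integral_deriv_eq_sub]
  refine intervalIntegral.integral_mono_ae_restrict hab hf.intervalIntegrable_deriv hm ?_
  rw [EventuallyLE, ae_restrict_iff' measurableSet_Icc]
  filter_upwards [h, hf.ae_differentiableAt] with t h1 h2 ht
  exact h1 ht _ (h2 (by rwa [uIcc_of_le hab])).hasDerivAt

/-- The positive part of `f` is absolutely continuous; its derivative agrees with that of `f` where
`f > 0` and vanishes elsewhere, these being minima. -/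
theorem nonpos_of_ae_deriv_nonpos {f : ℝ → ℝ} {a b : ℝ} (hab : a ≤ b)
    (hf : AbsolutelyContinuousOnInterval f a b) (ha : f a ≤ 0)
    (h : ∀ᵐ t, t ∈ Icc a b → ∀ d, HasDerivAt f d t → 0 < f t → d ≤ 0) : f b ≤ 0 := by
  have hac : AbsolutelyContinuousOnInterval (fun t => max (f t) 0) a b :=
    (LipschitzWith.id.max_const 0).comp_absolutelyContinuousOnInterval hf
  have := sub_le_integral_of_ae_deriv_le (m := fun _ => 0) hab hac (by simp) (by
    filter_upwards [h, hf.ae_differentiableAt] with t h1 h2 ht d hd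
    have hdiff := h2 (by rwa [uIcc_of_le hab])
    rcases lt_or_ge 0 (f t) with hpos | hneg
    · refine h1 ht d (hd.congr_of_eventuallyEq ?_) hpos
      filter_upwards [hdiff.continuousAt.eventually (lt_mem_nhds hpos)] with s hs
      exact (max_eq_left hs.le).symm
    · refine (IsLocalMin.hasDerivAt_eq_zero ?_ hd).le
      exact Eventually.of_forall fun s => by simp [hneg])
  simp only [max_eq_right ha, sub_zero, intervalIntegral.integral_zero] at this
  exact (le_max_left _ _).trans this

variable {E : Type*} [NormedAddCommGroup E] [InnerProductSpace ℝ E]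

theorem norm_le_add_integral {y : ℝ → E} {m : ℝ → ℝ} {a b : ℝ} (hab : a ≤ b)
    (hy : AbsolutelyContinuousOnInterval y a b) (hm : IntervalIntegrable m volume a b)
    (h : ∀ᵐ t, t ∈ Icc a b → 0 ≤ m t ∧ ∃ v, HasDerivAt y v t ∧ inner ℝ v (y t) ≤ m t * ‖y t‖) :
    ‖y b‖ ≤ ‖y a‖ + ∫ t in a..b, m t := by
  have := sub_le_integral_of_ae_deriv_le hab
    (lipschitzWith_one_norm.comp_absolutelyContinuousOnInterval hy) hm (by
    filter_upwards [h] with t h1 ht d hd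
    obtain ⟨hm0, v, hv, hle⟩ := h1 ht
    -- At a zero of `y` the norm is minimal, so its derivative, if any, is `0`. Elsewhere
    -- differentiating `‖y‖ ^ 2` in two ways allows division by `‖y t‖`.
    rcases eq_or_ne (y t) 0 with h0 | h0
    · have : d = 0 := IsLocalMin.hasDerivAt_eq_zero
        (Eventually.of_forall fun s => by simp [h0]) hd
      rwa [this]
    · have e := hv.norm_sq.unique (hd.pow 2)
      rw [real_inner_comm] at e
      have hpos := norm_pos_iff.2 h0
      norm_num at e
      refine le_of_mul_le_mul_right ?_ hpos
      linarith)
  linarith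

theorem norm_sub_le_integral {y : ℝ → E} {m : ℝ → ℝ} {a b : ℝ} (hab : a ≤ b)
    (hy : AbsolutelyContinuousOnInterval y a b) (hm : IntervalIntegrable m volume a b)
    (h : ∀ᵐ t, t ∈ Icc a b → ∃ v, HasDerivAt y v t ∧ ‖v‖ ≤ m t) :
    ‖y b - y a‖ ≤ ∫ t in a..b, m t := by
  have hac : AbsolutelyContinuousOnInterval (fun t => y t - y a) a b :=
    absolutelyContinuousOnInterval_of_dist_le hy 1 fun s _ t _ => by simp
  have := norm_le_add_integral hab hac hm (by
    filter_upwards [h] with t h1 ht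
    obtain ⟨v, hv, hle⟩ := h1 ht
    refine ⟨(norm_nonneg v).trans hle, v, hv.sub_const _, ?_⟩
    exact (real_inner_le_norm _ _).trans (by gcongr))
  simpa using this

theorem norm_sq_le_add_integral {y : ℝ → E} {m : ℝ → ℝ} {a b : ℝ} (hab : a ≤ b)
    (hy : AbsolutelyContinuousOnInterval y a b) (hm : IntervalIntegrable m volume a b)
    (h : ∀ᵐ t, t ∈ Icc a b → ∃ v, HasDerivAt y v t ∧ inner ℝ v (y t) ≤ m t) :
    ‖y b‖ ^ 2 ≤ ‖y a‖ ^ 2 + 2 * ∫ t in a..b, m t := by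
  have hac := lipschitzWith_one_norm.comp_absolutelyContinuousOnInterval hy
  have hsq : AbsolutelyContinuousOnInterval (fun t => ‖y t‖ ^ 2) a b := by
    simpa only [pow_two] using hac.fun_mul hac
  have := sub_le_integral_of_ae_deriv_le hab hsq (hm.const_mul 2) (by
    filter_upwards [h] with t h1 ht d hd
    obtain ⟨v, hv, hle⟩ := h1 ht
    rw [hd.unique hv.norm_sq, real_inner_comm]
    linarith)
  rw [intervalIntegral.integral_const_mul] at this
  linarith

/-- The integrand is almost everywhere the derivative of the `(n + 1)`-st power of the primitive, up
to a factor. This produces the factorials in the Picard iteration. -/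
theorem integral_mul_primitive_pow {κ : ℝ → ℝ} {a b : ℝ}
    (hκ : IntervalIntegrable κ volume a b) (n : ℕ) :
    ∫ t in a..b, κ t * (∫ s in a..t, κ s) ^ n = (∫ s in a..b, κ s) ^ (n + 1) / (n + 1) := by
  have hL : AbsolutelyContinuousOnInterval (fun t => ∫ s in a..t, κ s) a b :=
    absolutelyContinuousOnInterval_primitive hκ
  have hpow : ∀ k : ℕ, AbsolutelyContinuousOnInterval (fun t => (∫ s in a..t, κ s) ^ k) a b := by
    intro k
    induction k with
    | zero => simpa using (LipschitzWith.const (1 : ℝ)).comp_absolutelyContinuousOnInterval hL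
    | succ k ih => simpa only [pow_succ] using ih.fun_mul hL
  have h1 := (hpow (n + 1)).integral_deriv_eq_sub
  rw [intervalIntegral.integral_same, zero_pow n.succ_ne_zero, sub_zero] at h1
  rw [← h1, eq_div_iff (by positivity), mul_comm, ← intervalIntegral.integral_const_mul]
  refine intervalIntegral.integral_congr_ae ?_
  filter_upwards [hκ.ae_hasDerivAt_integral] with t ht htI
  have := ((ht (uIoc_subset_uIcc htI) a left_mem_uIcc).pow (n + 1)).deriv
  have e : (fun t => (∫ s in a..t, κ s) ^ (n + 1)) = (fun t => ∫ s in a..t, κ s) ^ (n + 1) := rfl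
  rw [e, this]
  push_cast
  ring

end AbsolutelyContinuous

/-! ### Carathéodory differential equations. -/

section Caratheodory

variable {E : Type*} [NormedAddCommGroup E]

/-- For a simple function in place of `x` the composition is a finite sum of indicators; the
Lipschitz bound passes to the pointwise limit. -/
theorem aestronglyMeasurable_comp_of_lipschitz {H : ℝ → E → E} {κ : ℝ → ℝ} {S : Set ℝ}
    (hS : MeasurableSet S) (hLip : ∀ t ∈ S, ∀ x y, ‖H t x - H t y‖ ≤ κ t * ‖x - y‖)
    (hmeas : ∀ x, AEStronglyMeasurable (fun t => H t x) (volume.restrict S))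
    {x : ℝ → E} (hx : StronglyMeasurable x) :
    AEStronglyMeasurable (fun t => H t (x t)) (volume.restrict S) := by
  refine aestronglyMeasurable_of_tendsto_ae atTop (f := fun n t => H t (hx.approx n t))
    (fun n => ?_) ?_
  · have : (fun t => H t (hx.approx n t)) = fun t => ∑ c ∈ (hx.approx n).range,
        ((hx.approx n) ⁻¹' {c}).indicator (fun t => H t c) t := by
      ext t
      rw [Finset.sum_eq_single (hx.approx n t)]
      · simp
      · intro c _ hc
        exact indicator_of_notMem (fun h => hc h.symm) _
      · intro h
        simp at h
    rw [this]
    exact Finset.aestronglyMeasurable_fun_sum _ fun c _ =>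
      (hmeas c).indicator ((hx.approx n).measurableSet_fiber c)
  · rw [ae_restrict_iff' hS]
    refine Eventually.of_forall fun t ht => ?_
    rw [tendsto_iff_norm_sub_tendsto_zero]
    have h0 := (tendsto_iff_norm_sub_tendsto_zero.1 (hx.tendsto_approx t)).const_mul (κ t)
    rw [mul_zero] at h0
    exact squeeze_zero (fun _ => norm_nonneg _) (fun n => hLip t ht _ _) h0

theorem intervalIntegrable_comp_of_lipschitz {T : ℝ} (hT : 0 ≤ T) {H : ℝ → E → E}
    {κ : ℝ → ℝ} (hκ : IntervalIntegrable κ volume 0 T)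
    (hLip : ∀ t ∈ Icc 0 T, ∀ x y, ‖H t x - H t y‖ ≤ κ t * ‖x - y‖)
    (hmeas : ∀ x, AEStronglyMeasurable (fun t => H t x) (volume.restrict (Icc 0 T)))
    {x₀ : E} (hint : IntervalIntegrable (fun t => H t x₀) volume 0 T)
    {x : ℝ → E} (hx : Continuous x) :
    IntervalIntegrable (fun t => H t (x t)) volume 0 T := by
  have hdom : IntervalIntegrable (fun t => κ t * ‖x t - x₀‖ + ‖H t x₀‖) volume 0 T :=
    (hκ.mul_continuousOn (by fun_prop)).add hint.norm
  refine hdom.mono_fun' ?_ ?_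
  · rw [uIoc_of_le hT]
    exact (aestronglyMeasurable_comp_of_lipschitz measurableSet_Icc hLip hmeas
      hx.stronglyMeasurable).mono_set Ioc_subset_Icc_self
  · rw [uIoc_of_le hT, EventuallyLE, ae_restrict_iff' measurableSet_Ioc]
    refine Eventually.of_forall fun t ht => ?_
    have := hLip t (Ioc_subset_Icc_self ht) (x t) x₀
    have h2 := norm_le_norm_sub_add (H t (x t)) (H t x₀)
    linarith

variable [NormedSpace ℝ E] [CompleteSpace E]

/-- Global existence for ordinary differential equations whose right-hand side is measurable in
time and Lipschitz in space with an integrable constant. -/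
theorem exists_caratheodory_solution {T : ℝ} (hT : 0 ≤ T) {H : ℝ → E → E}
    {κ : ℝ → ℝ} (hκ : IntervalIntegrable κ volume 0 T) (hκ0 : ∀ t ∈ Icc 0 T, 0 ≤ κ t)
    (hLip : ∀ t ∈ Icc 0 T, ∀ x y, ‖H t x - H t y‖ ≤ κ t * ‖x - y‖)
    (hmeas : ∀ x, AEStronglyMeasurable (fun t => H t x) (volume.restrict (Icc 0 T)))
    {x₀ : E} (hint : IntervalIntegrable (fun t => H t x₀) volume 0 T) :
    ∃ x : ℝ → E, AbsolutelyContinuousOnInterval x 0 T ∧ x 0 = x₀ ∧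
      ∀ᵐ t, t ∈ Icc 0 T → HasDerivAt x (H t (x t)) t := by
  have hI : ∀ x : C(Icc (0 : ℝ) T, E),
      IntervalIntegrable (fun s => H s (x (projIcc 0 T hT s))) volume 0 T := fun x =>
    intervalIntegrable_comp_of_lipschitz hT hκ hLip hmeas hint
      (x := fun s => x (projIcc 0 T hT s)) (by fun_prop)
  have hsub : ∀ t : Icc (0 : ℝ) T, uIcc 0 (t : ℝ) ⊆ uIcc 0 T := fun t =>
    uIcc_subset_uIcc left_mem_uIcc (by rw [uIcc_of_le hT]; exact t.2)
  -- The Picard operator; `projIcc` extends a curve on the interval to the whole line.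
  let Φ : C(Icc (0 : ℝ) T, E) → C(Icc (0 : ℝ) T, E) := fun x =>
    ⟨fun t => x₀ + ∫ s in (0 : ℝ)..t, H s (x (projIcc 0 T hT s)), by
      have := (absolutelyContinuousOnInterval_primitive (hI x)).continuousOn
      rw [uIcc_of_le hT] at this
      exact continuous_const.add (continuousOn_iff_continuous_domRestrict.1 this)⟩
  set L : ℝ → ℝ := fun t => ∫ s in (0 : ℝ)..t, κ s with hL
  have hLcont : ContinuousOn L (uIcc 0 T) :=
    (absolutelyContinuousOnInterval_primitive hκ).continuousOn
  -- Iterates gain `L ^ n / n!`, so some power of `Φ` contracts on the whole interval, however large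
  -- `L T` is.
  have hiter : ∀ (n : ℕ) (x y : C(Icc (0 : ℝ) T, E)) (t : Icc (0 : ℝ) T),
      ‖(Φ^[n] x) t - (Φ^[n] y) t‖ ≤ L t ^ n / n.factorial * dist x y := by
    intro n x y
    induction n with
    | zero => intro t; simpa [dist_eq_norm] using ContinuousMap.dist_apply_le_dist (f := x) (g := y) t
    | succ n ih =>
      intro t
      rw [Function.iterate_succ_apply', Function.iterate_succ_apply']
      set x' := Φ^[n] x
      set y' := Φ^[n] y
      have e : Φ x' t - Φ y' t = ∫ s in (0 : ℝ)..t,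
          (H s (x' (projIcc 0 T hT s)) - H s (y' (projIcc 0 T hT s))) := by
        rw [intervalIntegral.integral_sub ((hI x').mono_set (hsub t)) ((hI y').mono_set (hsub t))]
        simp [Φ]
      have hpos : (0 : ℝ) < n.factorial := by positivity
      rw [e]
      calc _ ≤ ∫ s in (0 : ℝ)..t, κ s * L s ^ n * (dist x y / n.factorial) := by
            refine intervalIntegral.norm_integral_le_of_norm_le t.2.1 ?_ ?_
            · refine Eventually.of_forall fun s hs => ?_
              have hsI : s ∈ Icc 0 T := ⟨hs.1.le, hs.2.trans t.2.2⟩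
              refine (hLip s hsI _ _).trans ?_
              rw [mul_assoc]
              refine mul_le_mul_of_nonneg_left ((ih _).trans_eq ?_) (hκ0 s hsI)
              rw [projIcc_of_mem hT hsI]
              ring
            · have := (hκ.mul_continuousOn (hLcont.pow n)).mono_set (hsub t)
              exact this.mul_const _
        _ = L t ^ (n + 1) / (n + 1).factorial * dist x y := by
            rw [intervalIntegral.integral_mul_const,
              integral_mul_primitive_pow (hκ.mono_set (hsub t)), Nat.factorial_succ]
            push_cast
            field_simp
            exact mul_comm _ _
  have hLmono : ∀ t : Icc (0 : ℝ) T, 0 ≤ L t ∧ L t ≤ L T := fun t => by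
    refine ⟨intervalIntegral.integral_nonneg t.2.1 fun s hs => hκ0 s ⟨hs.1, hs.2.trans t.2.2⟩, ?_⟩
    have h1 := intervalIntegral.integral_interval_sub_left hκ (hκ.mono_set (hsub t))
    have h2 : 0 ≤ ∫ s in (t : ℝ)..T, κ s :=
      intervalIntegral.integral_nonneg t.2.2 fun s hs => hκ0 s ⟨t.2.1.trans hs.1, hs.2⟩
    simp only [hL]
    linarith
  obtain ⟨n, hn⟩ := ((FloorSemiring.tendsto_pow_div_factorial_atTop (L T)).eventually
    (ge_mem_nhds (by norm_num : (0 : ℝ) < 1 / 2))).exists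
  have hcontr : ContractingWith (1 / 2) Φ^[n] := by
    refine ⟨by norm_num [← NNReal.coe_lt_coe], LipschitzWith.of_dist_le_mul fun x y => ?_⟩
    rw [ContinuousMap.dist_le (by positivity)]
    intro t
    rw [dist_eq_norm]
    refine (hiter n x y t).trans (mul_le_mul_of_nonneg_right ?_ dist_nonneg)
    refine le_trans ?_ (hn.trans_eq (by norm_num))
    have := hLmono t
    gcongr
    exacts [this.1, this.2]
  -- The fixed point of a contracting iterate is a fixed point of `Φ` itself.
  have hfix := hcontr.isFixedPt_fixedPoint_iterate
  set x := ContractingWith.fixedPoint Φ^[n] hcontr with hx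
  have hxt : ∀ t : Icc (0 : ℝ) T, x t = x₀ + ∫ s in (0 : ℝ)..t, H s (x (projIcc 0 T hT s)) := by
    intro t
    conv_lhs => rw [← hfix]
    rfl
  refine ⟨fun t => x₀ + ∫ s in (0 : ℝ)..t, H s (x (projIcc 0 T hT s)), ?_, by simp, ?_⟩
  · exact absolutelyContinuousOnInterval_of_dist_le
      (absolutelyContinuousOnInterval_primitive (hI x)) 1 fun s _ t _ => by simp
  · filter_upwards [(hI x).ae_hasDerivAt_integral] with t ht htI
    have h1 := (ht (by rwa [uIcc_of_le hT]) 0 left_mem_uIcc).const_add x₀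
    rwa [projIcc_of_mem hT htI, hxt] at h1

end Caratheodory

/-! ### Measurability of resolvents in time and parameter. -/

section Measurability

theorem OuterSemicontinuousOn.mem_of_tendsto {Y : Type*} [TopologicalSpace Y] {G : ℝ → Set Y}
    {I : Set ℝ} (hG : OuterSemicontinuousOn G I) {t : ℕ → ℝ} {s : ℕ → Y} {a : ℝ} {ξ : Y}
    (ht : ∀ n, t n ∈ I) (ha : a ∈ I) (hs : ∀ n, s n ∈ G (t n)) (hta : Tendsto t atTop (𝓝 a))
    (hsξ : Tendsto s atTop (𝓝 ξ)) : ξ ∈ G a :=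
  hG a ha ⟨t, ht, hta, id, strictMono_id, s, hs, hsξ⟩

variable {E : Type*} [NormedAddCommGroup E] [InnerProductSpace ℝ E] [FiniteDimensional ℝ E]
  [MeasurableSpace E] [BorelSpace E]

/-- For compact `K`, outer semicontinuity and uniqueness of the resolvent make the preimage of `K`
relatively closed in `I ×ˢ Ioi 0`; closed sets are exhausted by compact ones. Joint measurability in
time and parameter permits the substitution of a time-dependent parameter. -/
theorem measurable_indicator_resolvent {I : Set ℝ} (hI : MeasurableSet I) {F : ℝ → E → Set E}
    (hA : ∀ t ∈ I, IsMaximalMonotone (F t))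
    (hF : OuterSemicontinuousOn (fun t => graph (F t)) I) (x : E) :
    Measurable ((I ×ˢ Ioi (0 : ℝ)).indicator fun q => resolvent (F q.1) q.2 x) := by
  set S := I ×ˢ Ioi (0 : ℝ) with hS
  set R : ℝ × ℝ → E := fun q => resolvent (F q.1) q.2 x with hR
  have hSm : MeasurableSet S := hI.prod measurableSet_Ioi
  have hcpt : ∀ K : Set E, IsCompact K → MeasurableSet (S ∩ R ⁻¹' K) := by
    intro K hK
    have : S ∩ R ⁻¹' K = S ∩ closure (S ∩ R ⁻¹' K) := by
      refine Subset.antisymm (fun q hq => ⟨hq.1, subset_closure hq⟩) fun q hq => ⟨hq.1, ?_⟩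
      obtain ⟨p, hp, hpq⟩ := mem_closure_iff_seq_limit.1 hq.2
      obtain ⟨z, hzK, θ, hθ, hz⟩ := hK.tendsto_subseq fun n => (hp n).2
      have hpθ := hpq.comp hθ.tendsto_atTop
      have h1 : Tendsto (fun n => (p (θ n)).1) atTop (𝓝 q.1) :=
        (continuous_fst.tendsto q).comp hpθ
      have h2 : Tendsto (fun n => (p (θ n)).2) atTop (𝓝 q.2) :=
        (continuous_snd.tendsto q).comp hpθ
      have hq0 : 0 < q.2 := hq.1.2
      have hmem : ((z, q.2⁻¹ • (x - z)) : E × E) ∈ graph (F q.1) :=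
        hF.mem_of_tendsto (t := fun n => (p (θ n)).1)
          (s := fun n => (R (p (θ n)), (p (θ n)).2⁻¹ • (x - R (p (θ n)))))
          (fun n => (hp (θ n)).1.1) hq.1.1
          (fun n => (hA _ (hp (θ n)).1.1).resolvent_spec (hp (θ n)).1.2 x) h1
          (hz.prodMk_nhds ((h2.inv₀ hq0.ne').smul (tendsto_const_nhds.sub hz)))
      have : z = R q := (hA _ hq.1.1).eq_resolvent hq0 hmem
      rw [mem_preimage, ← this]
      exact hzK
    rw [this]
    exact hSm.inter isClosed_closure.measurableSet
  refine measurable_of_isClosed fun K hK => ?_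
  have h1 : S ∩ R ⁻¹' K = ⋃ n : ℕ, S ∩ R ⁻¹' (K ∩ Metric.closedBall 0 n) := by
    rw [← inter_iUnion, ← preimage_iUnion, ← inter_iUnion, Metric.iUnion_closedBall_nat,
      inter_univ]
  have h2 : MeasurableSet (S ∩ R ⁻¹' K) := by
    rw [h1]
    exact MeasurableSet.iUnion fun n => hcpt _ ((isCompact_closedBall _ _).inter_left hK)
  rw [indicator_preimage, Set.ite, inter_comm]
  exact h2.union ((measurable_const hK.measurableSet).diff hSm)

theorem aestronglyMeasurable_resolvent {I : Set ℝ} (hI : MeasurableSet I) {F : ℝ → E → Set E}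
    (hA : ∀ t ∈ I, IsMaximalMonotone (F t))
    (hF : OuterSemicontinuousOn (fun t => graph (F t)) I) (x : E) {c : ℝ → ℝ}
    (hc : AEMeasurable c (volume.restrict I)) (hc0 : ∀ t ∈ I, 0 < c t) :
    AEStronglyMeasurable (fun t => resolvent (F t) (c t) x) (volume.restrict I) := by
  have h := (measurable_indicator_resolvent hI hA hF x).comp_aemeasurable
    (aemeasurable_id.prodMk hc)
  refine (h.congr ?_).aestronglyMeasurable
  rw [EventuallyEq, ae_restrict_iff' hI]
  refine Eventually.of_forall fun t ht => ?_
  simp [ht, hc0 t ht]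

end Measurability

/-! ### Distance to a moving convex set. -/

section Distance

variable {E : Type*} [NormedAddCommGroup E] [NormedSpace ℝ E]

/-- Differentiability of `x` makes the last term `o(r)`, so it disappears from the difference
quotient. -/
theorem deriv_le_of_eventually_le {ψ : ℝ → ℝ} {x : ℝ → E} {s d c : ℝ} {v : E}
    (hψ : HasDerivAt ψ d s) (hx : HasDerivAt x v s)
    (h : ∀ᶠ r in 𝓝[>] (0 : ℝ), ψ (s + r) ≤ ψ s + r * c + ‖x (s + r) - x s - r • v‖) :
    d ≤ c := by
  have h1 := hψ.tendsto_slope_zero_right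
  have h2 := ((hx.tendsto_slope_zero_right.sub_const v).norm).const_add c
  rw [sub_self, norm_zero, add_zero] at h2
  refine le_of_tendsto_of_tendsto h1 h2 ?_
  filter_upwards [h, self_mem_nhdsWithin] with r hr hr0
  have hr0 : 0 < r := hr0
  have e : r⁻¹ • (x (s + r) - x s) - v = r⁻¹ • (x (s + r) - x s - r • v) := by
    rw [smul_sub _ _ (r • v), smul_smul, inv_mul_cancel₀ hr0.ne', one_smul]
  rw [e, norm_smul, norm_inv, Real.norm_of_nonneg hr0.le, smul_eq_mul, inv_mul_le_iff₀ hr0,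
    mul_add, mul_inv_cancel_left₀ hr0.ne']
  linarith

theorem _root_.Convex.infDist_combo_le [ProperSpace E] {C : Set E} (hC : Convex ℝ C)
    (hcl : IsClosed C) (hne : C.Nonempty) (x y : E) {a b : ℝ} (ha : 0 ≤ a) (hb : 0 ≤ b)
    (hab : a + b = 1) :
    Metric.infDist (a • x + b • y) C ≤ a * Metric.infDist x C + b * Metric.infDist y C := by
  obtain ⟨p, hp, hpx⟩ := hcl.exists_infDist_eq_dist hne x
  obtain ⟨q, hq, hqy⟩ := hcl.exists_infDist_eq_dist hne y
  refine (Metric.infDist_le_dist_of_mem (hC hp hq ha hb hab)).trans ?_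
  rw [hpx, hqy, dist_eq_norm, dist_eq_norm, dist_eq_norm]
  have e : a • x + b • y - (a • p + b • q) = a • (x - p) + b • (y - q) := by module
  rw [e]
  refine (norm_add_le _ _).trans_eq ?_
  rw [norm_smul, norm_smul, Real.norm_of_nonneg ha, Real.norm_of_nonneg hb]

/-- A trajectory that is attracted by `C t` at rate `g t / ε`, where `g` dominates the speed of
`C` and the perturbation, stays within `ε` of `C t`. -/
theorem infDist_le_of_relaxation [ProperSpace E] {T : ℝ} {C : ℝ → Set E} {φ : ℝ → ℝ}
    (hconv : ∀ t ∈ Icc 0 T, Convex ℝ (C t)) (hcl : ∀ t ∈ Icc 0 T, IsClosed (C t))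
    (hne : ∀ t ∈ Icc 0 T, (C t).Nonempty) (hφ : AbsolutelyContinuousOnInterval φ 0 T)
    (hex : ∀ s t, 0 ≤ s → s ≤ t → t ≤ T → ∀ z ∈ C s, Metric.infDist z (C t) ≤ φ t - φ s)
    {x : ℝ → E} (hx : AbsolutelyContinuousOnInterval x 0 T) (hx0 : x 0 ∈ C 0) {ε : ℝ}
    (hε : 0 < ε) {g : ℝ → ℝ} {G u : ℝ → E} (hG : ∀ t ∈ Icc 0 T, G t ∈ C t)
    (hg : ∀ t ∈ Icc 0 T, ‖u t‖ + |deriv φ t| ≤ g t)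
    (hder : ∀ᵐ t, t ∈ Icc 0 T → HasDerivAt x ((g t / ε) • (G t - x t) + u t) t) :
    ∀ t ∈ Icc 0 T, Metric.infDist (x t) (C t) ≤ ε := by
  intro t ht
  have hsub : uIcc 0 t ⊆ uIcc 0 T :=
    uIcc_subset_uIcc left_mem_uIcc (by rw [uIcc_of_le (ht.1.trans ht.2)]; exact ht)
  have hψac : AbsolutelyContinuousOnInterval (fun s => Metric.infDist (x s) (C t)) 0 t :=
    (Metric.lipschitz_infDist_pt (C t)).comp_absolutelyContinuousOnInterval (hx.mono hsub)
  -- The target `C t` is frozen at the final time, so no distance to a moving set is differentiated;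
  -- `φ s - φ t` accounts for the motion between `s` and `t`. Where this function is positive, the
  -- attraction exceeds `g s`, which dominates the perturbation and `deriv φ s`.
  have hac : AbsolutelyContinuousOnInterval
      (fun s => Metric.infDist (x s) (C t) + φ s - (φ t + ε)) 0 t :=
    absolutelyContinuousOnInterval_of_dist_le (hψac.fun_add (hφ.mono hsub)) 1
      fun s _ t _ => by simp
  have key := nonpos_of_ae_deriv_nonpos ht.1 hac (by
    have := hex 0 t le_rfl ht.1 ht.2 _ hx0
    linarith) (by
    filter_upwards [hder, (hφ.mono hsub).ae_differentiableAt] with s hs hsφ hst d hd hpos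
    have hsT : s ∈ Icc 0 T := ⟨hst.1, hst.2.trans ht.2⟩
    have hxs := hs hsT
    have hφs := (hsφ (by rwa [uIcc_of_le ht.1])).hasDerivAt
    have hψs : HasDerivAt (fun s => Metric.infDist (x s) (C t)) (d - deriv φ s) s := by
      have := (hd.sub hφs).add_const (φ t + ε)
      refine this.congr_of_eventuallyEq (Eventually.of_forall fun r => ?_)
      simp only [Pi.sub_apply]
      ring
    set κ := g s / ε with hκ
    have hg0 : 0 ≤ g s := le_trans (by positivity) (hg s hsT)
    have hκ0 : 0 ≤ κ := by positivity
    have hle := deriv_le_of_eventually_le (c := κ * (φ t - φ s) -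
      κ * Metric.infDist (x s) (C t) + ‖u s‖) hψs hxs (by
      have hev : ∀ᶠ r in 𝓝[>] (0 : ℝ), r * κ ≤ 1 := by
        have : Tendsto (fun r : ℝ => r * κ) (𝓝[>] 0) (𝓝 0) := by
          have : Tendsto (fun r : ℝ => r * κ) (𝓝 0) (𝓝 (0 * κ)) := tendsto_id.mul_const κ
          rw [zero_mul] at this
          exact this.mono_left nhdsWithin_le_nhds
        exact this.eventually (ge_mem_nhds one_pos)
      filter_upwards [hev, self_mem_nhdsWithin] with r hr hr0
      have hr0 : 0 < r := hr0
      set v := κ • (G s - x s) + u s with hv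
      have h1 : Metric.infDist (x (s + r)) (C t) ≤
          Metric.infDist (x s + r • v) (C t) + ‖x (s + r) - x s - r • v‖ := by
        have := Metric.infDist_le_infDist_add_dist (s := C t) (x := x (s + r)) (y := x s + r • v)
        rwa [dist_eq_norm, ← sub_sub] at this
      -- An Euler step is a convex combination of `x s` and `G s`, shifted by `r • u s`; convexity
      -- of the distance then applies.
      have h2 : Metric.infDist (x s + r • v) (C t) ≤
          Metric.infDist ((1 - r * κ) • x s + (r * κ) • G s) (C t) + r * ‖u s‖ := by
        have := Metric.infDist_le_infDist_add_dist (s := C t) (x := x s + r • v)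
          (y := (1 - r * κ) • x s + (r * κ) • G s)
        have e : x s + r • v - ((1 - r * κ) • x s + (r * κ) • G s) = r • u s := by
          rw [hv]; module
        rwa [dist_eq_norm, e, norm_smul, Real.norm_of_nonneg hr0.le] at this
      have h3 := (hconv t ht).infDist_combo_le (hcl t ht) (hne t ht) (x s) (G s)
        (sub_nonneg.2 hr) (mul_nonneg hr0.le hκ0) (by ring)
      have h4 := mul_le_mul_of_nonneg_left (hex s t hst.1 hst.2 ht.2 _ (hG s hsT))
        (mul_nonneg hr0.le hκ0)
      linarith)
    have h5 := hg s hsT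
    have h6 := le_abs_self (deriv φ s)
    have h7 : κ * ε = g s := by rw [hκ]; field_simp
    have h8 := mul_nonneg hκ0 hpos.le
    linarith)
  linarith

end Distance

/-! ### Convergence of approximate solutions. -/

section Convergence

theorem intervalIntegral_mono_right_of_nonneg {f : ℝ → ℝ} {T t : ℝ}
    (hf : IntervalIntegrable f volume 0 T) (hf0 : ∀ s ∈ Icc 0 T, 0 ≤ f s) (ht : t ∈ Icc 0 T) :
    ∫ s in (0 : ℝ)..t, f s ≤ ∫ s in (0 : ℝ)..T, f s := by
  have hft := hf.mono_set
    (uIcc_subset_uIcc left_mem_uIcc (by rw [uIcc_of_le (ht.1.trans ht.2)]; exact ht))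
  have h1 := intervalIntegral.integral_interval_sub_left hf hft
  have h2 : 0 ≤ ∫ s in t..T, f s :=
    intervalIntegral.integral_nonneg ht.2 fun s hs => hf0 s ⟨ht.1.trans hs.1, hs.2⟩
  linarith

variable {E : Type*} [NormedAddCommGroup E] [InnerProductSpace ℝ E]

/-- `x` solves `x' = -w + u` where `w t` is a value of `F t` at a point `J t` within `ε` of
`x t`, and `w` is dominated by `g`. -/
structure IsApproxSolution (T : ℝ) (F : ℝ → E → Set E) (u : ℝ → E) (g : ℝ → ℝ) (x₀ : E) (ε : ℝ)
    (x J w : ℝ → E) : Prop where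
  absCont : AbsolutelyContinuousOnInterval x 0 T
  initial : x 0 = x₀
  mem : ∀ t ∈ Icc 0 T, w t ∈ F t (J t)
  norm_sub_le : ∀ t ∈ Icc 0 T, ‖J t - x t‖ ≤ ε
  norm_le : ∀ t ∈ Icc 0 T, ‖w t‖ ≤ g t
  hasDerivAt : ∀ᵐ t, t ∈ Icc 0 T → HasDerivAt x (-w t + u t) t

variable {T : ℝ} {F : ℝ → E → Set E} {u : ℝ → E} {g : ℝ → ℝ} {x₀ : E}

/-- Monotonicity is available at `J` and `K`, not at `x` and `y`. Passing between them costs `ε + δ`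
times `‖w - v‖ ≤ 2 * g`, and differentiating the square doubles this. -/
theorem IsApproxSolution.norm_sub_sq_le (hF : ∀ t ∈ Icc 0 T, IsMonotone (F t))
    (hg : IntervalIntegrable g volume 0 T) {ε δ : ℝ} (hε : 0 ≤ ε) (hδ : 0 ≤ δ)
    {x J w y K v : ℝ → E}
    (h : IsApproxSolution T F u g x₀ ε x J w) (h' : IsApproxSolution T F u g x₀ δ y K v)
    {t : ℝ} (ht : t ∈ Icc 0 T) :
    ‖x t - y t‖ ^ 2 ≤ 4 * (ε + δ) * ∫ s in (0 : ℝ)..T, g s := by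
  have hsub : uIcc 0 t ⊆ uIcc 0 T :=
    uIcc_subset_uIcc left_mem_uIcc (by rw [uIcc_of_le (ht.1.trans ht.2)]; exact ht)
  have hgt := hg.mono_set hsub
  have key := norm_sq_le_add_integral ht.1 ((h.absCont.fun_sub h'.absCont).mono hsub)
    (hgt.const_mul (2 * (ε + δ))) (by
    filter_upwards [h.hasDerivAt, h'.hasDerivAt] with s hs hs' hst
    have hsT : s ∈ Icc 0 T := ⟨hst.1, hst.2.trans ht.2⟩
    refine ⟨_, (hs hsT).sub (hs' hsT), ?_⟩
    have hmon := hF s hsT _ _ _ _ (h.mem s hsT) (h'.mem s hsT)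
    have e : inner ℝ (-w s + u s - (-v s + u s)) (x s - y s) =
        -inner ℝ (J s - K s) (w s - v s) + inner ℝ (w s - v s) ((J s - x s) - (K s - y s)) := by
      have e1 : -w s + u s - (-v s + u s) = -(w s - v s) := by abel
      have e2 : x s - y s = (J s - K s) - ((J s - x s) - (K s - y s)) := by abel
      rw [e1, e2, inner_neg_left, inner_sub_right, real_inner_comm (w s - v s) (J s - K s)]
      ring
    have h1 := real_inner_le_norm (w s - v s) ((J s - x s) - (K s - y s))
    have h2 : ‖w s - v s‖ ≤ 2 * g s := by
      have := _root_.norm_sub_le (w s) (v s)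
      linarith [h.norm_le s hsT, h'.norm_le s hsT]
    have h3 : ‖(J s - x s) - (K s - y s)‖ ≤ ε + δ :=
      (_root_.norm_sub_le _ _).trans (add_le_add (h.norm_sub_le s hsT) (h'.norm_sub_le s hsT))
    have h4 : ‖w s - v s‖ * ‖(J s - x s) - (K s - y s)‖ ≤ 2 * g s * (ε + δ) := by
      gcongr
      exact (norm_nonneg _).trans h2
    rw [e]
    linarith)
  rw [intervalIntegral.integral_const_mul] at key
  have h5 := intervalIntegral_mono_right_of_nonneg hg
    (fun s hs => (norm_nonneg _).trans (h.norm_le s hs)) ht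
  have h6 := mul_le_mul_of_nonneg_left h5 (by positivity : 0 ≤ 4 * (ε + δ))
  rw [h.initial, h'.initial, sub_self, norm_zero] at key
  linarith

theorem IsApproxSolution.norm_sub_le_integral (hg : IntervalIntegrable g volume 0 T)
    (hug : ∀ t ∈ Icc 0 T, ‖u t‖ ≤ g t) {ε : ℝ} {x J w : ℝ → E}
    (h : IsApproxSolution T F u g x₀ ε x J w) {s t : ℝ} (hs : 0 ≤ s) (hst : s ≤ t) (ht : t ≤ T) :
    ‖x t - x s‖ ≤ ∫ r in s..t, 2 * g r := by
  have hsub : uIcc s t ⊆ uIcc 0 T := by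
    rw [uIcc_of_le hst, uIcc_of_le (hs.trans (hst.trans ht))]
    exact Icc_subset_Icc hs ht
  refine EvolInclusion.norm_sub_le_integral hst (h.absCont.mono hsub)
    ((hg.mono_set hsub).const_mul 2) ?_
  filter_upwards [h.hasDerivAt] with r hr hrst
  have hrT : r ∈ Icc 0 T := ⟨hs.trans hrst.1, hrst.2.trans ht⟩
  refine ⟨_, hr hrT, ?_⟩
  have := norm_add_le (-w r) (u r)
  rw [norm_neg] at this
  linarith [h.norm_le r hrT, hug r hrT]

/-- For a pointwise limit of absolutely continuous functions with dominated derivatives, the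
derivative of the limit is at most the supremum of the derivatives. -/
theorem ae_deriv_le_iSup {f : ℕ → ℝ → ℝ} {f₀ : ℝ → ℝ} (hT : 0 ≤ T)
    (hg : IntervalIntegrable g volume 0 T)
    (hf : ∀ n, AbsolutelyContinuousOnInterval (f n) 0 T)
    (hfg : ∀ n, ∀ᵐ t, t ∈ Icc 0 T → |deriv (f n) t| ≤ g t)
    (hlim : ∀ t ∈ Icc 0 T, Tendsto (fun n => f n t) atTop (𝓝 (f₀ t))) :
    ∀ᵐ t, t ∈ Icc 0 T → ∀ d, HasDerivAt f₀ d t → d ≤ ⨆ n, deriv (f n) t := by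
  set S : ℝ → ℝ := fun t => ⨆ n, deriv (f n) t with hS
  have hfg' := ae_all_iff.2 hfg
  have hbdd : ∀ᵐ t, t ∈ Icc 0 T → ∀ n, deriv (f n) t ≤ S t := by
    filter_upwards [hfg'] with t ht htT n
    exact le_ciSup (f := fun n => deriv (f n) t)
      ⟨g t, by rintro _ ⟨k, rfl⟩; exact (le_abs_self _).trans (ht k htT)⟩ n
  have hSint : IntervalIntegrable S volume 0 T := by
    refine hg.mono_fun' (Measurable.iSup fun n => measurable_deriv _).aestronglyMeasurable ?_
    rw [uIoc_of_le hT, EventuallyLE, ae_restrict_iff' measurableSet_Ioc]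
    filter_upwards [hfg', hbdd] with t ht htb htT
    have htI := Ioc_subset_Icc_self htT
    rw [Real.norm_eq_abs, abs_le]
    exact ⟨(neg_le_of_abs_le (ht 0 htI)).trans (htb htI 0),
      ciSup_le fun n => (le_abs_self _).trans (ht n htI)⟩
  -- The bound is passed to the limit in integrated form, then differentiated at points where the
  -- primitive of `S` has derivative `S t`.
  have hincr : ∀ a b, 0 ≤ a → a ≤ b → b ≤ T → f₀ b - f₀ a ≤ ∫ t in a..b, S t := by
    intro a b ha hab hb
    have hsub : uIcc a b ⊆ uIcc 0 T := by
      rw [uIcc_of_le hab, uIcc_of_le hT]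
      exact Icc_subset_Icc ha hb
    refine le_of_tendsto' ((hlim b ⟨ha.trans hab, hb⟩).sub (hlim a ⟨ha, hab.trans hb⟩)) fun n => ?_
    refine sub_le_integral_of_ae_deriv_le hab ((hf n).mono hsub) (hSint.mono_set hsub) ?_
    filter_upwards [hbdd] with t ht htab d hd
    rw [← hd.deriv]
    exact ht ⟨ha.trans htab.1, htab.2.trans hb⟩ n
  -- The endpoint `T` is discarded because difference quotients are taken to the right.
  filter_upwards [hSint.ae_hasDerivAt_integral, (measure_eq_zero_iff_ae_notMem (μ := volume)).1
    (measure_singleton T)] with t ht htne htT d hd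
  have hlt : t < T := lt_of_le_of_ne htT.2 htne
  have h1 := ht (by rwa [uIcc_of_le hT]) 0 left_mem_uIcc
  have h2 := deriv_le_of_eventually_le (c := 0) (x := fun _ => (0 : ℝ)) (hd.sub h1)
    (hasDerivAt_const t 0) (by
    filter_upwards [Ioo_mem_nhdsGT (sub_pos.2 hlt)] with r hr
    have h3 := hincr t (t + r) htT.1 (by linarith [hr.1]) (by linarith [hr.2])
    have h4 : ∀ s, 0 ≤ s → s ≤ T → IntervalIntegrable S volume 0 s := fun s h0 h1 =>
      hSint.mono_set (uIcc_subset_uIcc left_mem_uIcc (by rw [uIcc_of_le hT]; exact ⟨h0, h1⟩))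
    have h5 := intervalIntegral.integral_interval_sub_left
      (h4 (t + r) (by linarith [hr.1, htT.1]) (by linarith [hr.2])) (h4 t htT.1 htT.2)
    simp only [Pi.sub_apply, mul_zero, smul_zero, sub_self, norm_zero, add_zero]
    linarith)
  linarith

variable [FiniteDimensional ℝ E]

/-- The derivatives need not converge pointwise. It suffices that, in any given direction, the
derivative of the limit is nearly matched from below by that of some late approximation
(`ae_deriv_le_iSup` applied to tails). For a pair `(z, q)` of the graph, the direction `y t - z`
turns this and monotonicity into the inequality required by maximality. -/
theorem exists_solution_of_approx (hT : 0 ≤ T) (hF : ∀ t ∈ Icc 0 T, IsMaximalMonotone (F t))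
    (hg : IntervalIntegrable g volume 0 T) (hug : ∀ t ∈ Icc 0 T, ‖u t‖ ≤ g t)
    {ε : ℕ → ℝ} (hε : ∀ n, 0 ≤ ε n) (hε0 : Tendsto ε atTop (𝓝 0)) {x J w : ℕ → ℝ → E}
    (h : ∀ n, IsApproxSolution T F u g x₀ (ε n) (x n) (J n) (w n)) :
    ∃ y : ℝ → E, AbsolutelyContinuousOnInterval y 0 T ∧ y 0 = x₀ ∧
      ∀ᵐ t, t ∈ Icc 0 T → ∃ v, HasDerivAt y v t ∧ u t - v ∈ F t (y t) := by
  have hcauchy : ∀ t ∈ Icc 0 T, CauchySeq fun n => x n t := by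
    intro t ht
    set B := ∫ s in (0 : ℝ)..T, g s
    rw [Metric.cauchySeq_iff']
    intro η hη
    have hB : 0 ≤ B := intervalIntegral.integral_nonneg hT
      fun s hs => (norm_nonneg _).trans ((h 0).norm_le s hs)
    have hlim : Tendsto (fun n => 4 * (ε n) * B) atTop (𝓝 0) := by
      simpa using (hε0.const_mul 4).mul_const B
    obtain ⟨N, hN⟩ := eventually_atTop.1
      (hlim.eventually (gt_mem_nhds (by positivity : 0 < η ^ 2 / 2)))
    refine ⟨N, fun n hn => ?_⟩
    rw [dist_eq_norm]
    refine lt_of_pow_lt_pow_left₀ 2 hη.le ?_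
    have h1 := (h n).norm_sub_sq_le (fun t ht => (hF t ht).1) hg (hε n) (hε N) (h N) ht
    have h2 := hN n hn
    have h3 := hN N le_rfl
    have h4 : 4 * (ε n + ε N) * B = 4 * ε n * B + 4 * ε N * B := by ring
    linarith
  have hex : ∀ t, ∃ y, t ∈ Icc 0 T → Tendsto (fun n => x n t) atTop (𝓝 y) := fun t => by
    by_cases ht : t ∈ Icc 0 T
    · obtain ⟨y, hy⟩ := cauchySeq_tendsto_of_complete (hcauchy t ht)
      exact ⟨y, fun _ => hy⟩
    · exact ⟨0, fun h => absurd h ht⟩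
  choose y hy using hex
  have hsubT : ∀ s ∈ Icc 0 T, uIcc 0 s ⊆ uIcc 0 T := fun s hs =>
    uIcc_subset_uIcc left_mem_uIcc (by rwa [uIcc_of_le hT])
  have hyac : AbsolutelyContinuousOnInterval y 0 T := by
    refine absolutelyContinuousOnInterval_of_dist_le
      (absolutelyContinuousOnInterval_primitive (hg.const_mul 2)) 1 fun s hs t ht => ?_
    rw [uIcc_of_le hT] at hs ht
    have key : ∀ s ∈ Icc 0 T, ∀ t ∈ Icc 0 T, s ≤ t → dist (y s) (y t) ≤
        dist (∫ r in (0 : ℝ)..s, 2 * g r) (∫ r in (0 : ℝ)..t, 2 * g r) := by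
      intro s hs t ht hst
      rw [dist_comm, dist_eq_norm, dist_comm, Real.dist_eq,
        intervalIntegral.integral_interval_sub_left ((hg.const_mul 2).mono_set (hsubT t ht))
          ((hg.const_mul 2).mono_set (hsubT s hs))]
      refine le_of_tendsto' ((hy t ht).sub (hy s hs)).norm fun n => ?_
      exact ((h n).norm_sub_le_integral hg hug hs.1 hst ht.2).trans (le_abs_self _)
    rw [one_mul]
    rcases le_total s t with hst | hst
    · exact key s hs t ht hst
    · rw [dist_comm, dist_comm (∫ r in (0 : ℝ)..s, 2 * g r)]
      exact key t ht s hs hst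
  have h0T : (0 : ℝ) ∈ Icc 0 T := ⟨le_rfl, hT⟩
  refine ⟨y, hyac, tendsto_nhds_unique (hy 0 h0T) (by simp [(h _).initial]), ?_⟩
  have hder := ae_all_iff.2 fun n => (h n).hasDerivAt
  -- Directions from a dense sequence and tails indexed by `N` are countably many, so a single null
  -- set serves for all of them.
  have hdir : ∀ᵐ t, ∀ j N : ℕ, t ∈ Icc 0 T → ∀ d,
      HasDerivAt (fun t => inner ℝ (TopologicalSpace.denseSeq E j) (y t)) d t →
      d ≤ ⨆ k, deriv (fun t => inner ℝ (TopologicalSpace.denseSeq E j) (x (N + k) t)) t := by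
    rw [ae_all_iff]; intro j
    rw [ae_all_iff]; intro N
    set p := TopologicalSpace.denseSeq E j
    have hinner : ∀ v, AbsolutelyContinuousOnInterval v 0 T →
        AbsolutelyContinuousOnInterval (fun t => inner ℝ p (v t)) 0 T := fun v hv =>
      (innerSL ℝ p).lipschitz.comp_absolutelyContinuousOnInterval hv
    refine ae_deriv_le_iSup hT (hg.const_mul (2 * ‖p‖)) (fun k => hinner _ (h (N + k)).absCont)
      (fun k => ?_) fun t ht => ?_
    · filter_upwards [(h (N + k)).hasDerivAt] with t ht htT
      have e := ((hasDerivAt_const t p).inner ℝ (ht htT)).deriv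
      rw [e, inner_zero_left, add_zero]
      refine (abs_real_inner_le_norm _ _).trans ?_
      have h1 := norm_add_le (-w (N + k) t) (u t)
      rw [norm_neg] at h1
      have h2 : ‖-w (N + k) t + u t‖ ≤ 2 * g t := by
        linarith [(h (N + k)).norm_le t htT, hug t htT]
      calc _ ≤ ‖p‖ * (2 * g t) := by gcongr
        _ = _ := by ring
    · have h1 : Tendsto (fun k => x (N + k) t) atTop (𝓝 (y t)) := by
        simpa only [add_comm] using (tendsto_add_atTop_iff_nat N).2 (hy t ht)
      exact tendsto_const_nhds.inner h1
  filter_upwards [hder, hdir, hyac.boundedVariationOn.ae_differentiableAt_of_mem_uIcc]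
    with t hdt hdirt hdiff ht
  set v := deriv y t with hv
  have hyv : HasDerivAt y v t := (hdiff (by rwa [uIcc_of_le hT])).hasDerivAt
  refine ⟨v, hyv, (hF t ht).mem_of_forall fun z q hq => ?_⟩
  set p := y t - z with hp
  set ξ := u t - v with hξ
  have hg0 : 0 ≤ g t := (norm_nonneg _).trans ((h 0).norm_le t ht)
  -- The errors are `δ` from the supremum, `δ * (g t + ‖ξ‖)` from replacing `p` by `pj`, and `2 * δ
  -- * (g t + ‖q‖)` from replacing `J n t` by `y t`.
  have key : ∀ δ : ℝ, 0 < δ →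
      inner ℝ p q ≤ inner ℝ p ξ + δ * (1 + 3 * g t + ‖ξ‖ + 2 * ‖q‖) := by
    intro δ hδ
    obtain ⟨j, hj⟩ := (TopologicalSpace.denseRange_denseSeq E).exists_dist_lt p hδ
    set pj := TopologicalSpace.denseSeq E j
    obtain ⟨N, hN⟩ := eventually_atTop.1 ((hε0.eventually (gt_mem_nhds hδ)).and
      ((hy t ht).eventually (Metric.ball_mem_nhds _ hδ)))
    have hsup := hdirt j N ht _ ((hasDerivAt_const t pj).inner ℝ hyv)
    rw [inner_zero_left, add_zero] at hsup
    obtain ⟨k, hk⟩ := exists_lt_of_lt_ciSup ((sub_lt_self (inner ℝ pj v) hδ).trans_le hsup)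
    rw [((hasDerivAt_const t pj).inner ℝ (hdt (N + k) ht)).deriv, inner_zero_left, add_zero,
      inner_add_right, inner_neg_right] at hk
    obtain ⟨hεn, hxn⟩ := hN (N + k) (Nat.le_add_right N k)
    set n := N + k
    have hxn : ‖x n t - y t‖ < δ := by rwa [← dist_eq_norm]
    have hwn := (h n).norm_le t ht
    have hJn : ‖J n t - y t‖ ≤ 2 * δ := by
      have h1 := norm_sub_le_norm_sub_add_norm_sub (J n t) (x n t) (y t)
      have h2 := (h n).norm_sub_le t ht
      linarith
    have hmon := (hF t ht).1 _ _ _ _ ((h n).mem t ht) hq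
    have e1 : inner ℝ (J n t - z) (w n t - q) = inner ℝ p (w n t) - inner ℝ p q +
        inner ℝ (J n t - y t) (w n t - q) := by
      rw [← inner_sub_right, ← inner_add_left]
      congr 1
      rw [hp]; abel
    have e2 : inner ℝ p (w n t) - inner ℝ p ξ = inner ℝ pj (w n t) - inner ℝ pj ξ +
        inner ℝ (p - pj) (w n t - ξ) := by
      rw [← inner_sub_right, ← inner_sub_right, ← inner_add_left, add_sub_cancel]
    have e3 : inner ℝ pj (w n t) - inner ℝ pj ξ ≤ δ := by
      rw [hξ, inner_sub_right]
      linarith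
    have b1 : inner ℝ (J n t - y t) (w n t - q) ≤ 2 * δ * (g t + ‖q‖) := by
      refine (real_inner_le_norm _ _).trans ?_
      gcongr
      exact (norm_sub_le _ _).trans (by gcongr)
    have b2 : inner ℝ (p - pj) (w n t - ξ) ≤ δ * (g t + ‖ξ‖) := by
      refine (real_inner_le_norm _ _).trans ?_
      rw [dist_eq_norm] at hj
      gcongr
      exact (norm_sub_le _ _).trans (by gcongr)
    linarith
  by_contra! hlt
  rw [inner_sub_right] at hlt
  set K := 1 + 3 * g t + ‖ξ‖ + 2 * ‖q‖ with hK
  have hK0 : 0 < K := by positivity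
  have h1 := key ((inner ℝ p q - inner ℝ p ξ) / (2 * K)) (div_pos (by linarith) (by positivity))
  have h2 : (inner ℝ p q - inner ℝ p ξ) / (2 * K) * K = (inner ℝ p q - inner ℝ p ξ) / 2 := by
    field_simp
  linarith

end Convergence

/-! ### Tracking the domains, and the Yosida equation. -/

section Approximation

variable {E : Type*} [NormedAddCommGroup E] [InnerProductSpace ℝ E] [FiniteDimensional ℝ E]
  [MeasurableSpace E] [BorelSpace E] {T : ℝ} {F : ℝ → E → Set E} {φ : ℝ → ℝ}

/-- Absolutely continuous curves that follow the domains of `F t` up to `ε`, with a speed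
controlled by the motion of the domains alone. -/
theorem exists_domain_tracking (hT : 0 ≤ T) (hA : ∀ t ∈ Icc 0 T, IsMaximalMonotone (F t))
    (hF : OuterSemicontinuousOn (fun t => graph (F t)) (Icc 0 T))
    (hcl : ∀ t ∈ Icc 0 T, IsClosed (dom (F t))) (hφ : AbsolutelyContinuousOnInterval φ 0 T)
    (hex : ∀ s t, 0 ≤ s → s ≤ t → t ≤ T → ∀ z ∈ dom (F s),
      Metric.infDist z (dom (F t)) ≤ φ t - φ s)
    {x₀ : E} (hx₀ : x₀ ∈ dom (F 0)) {ε : ℝ} (hε : 0 < ε) :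
    ∃ z P : ℝ → E, AbsolutelyContinuousOnInterval z 0 T ∧ z 0 = x₀ ∧
      (∀ᵐ t, t ∈ Icc 0 T → ∃ v, HasDerivAt z v t ∧ ‖v‖ ≤ 1 + |deriv φ t|) ∧
      ∀ t ∈ Icc 0 T, P t ∈ dom (F t) ∧ ‖P t - z t‖ ≤ ε := by
  have hproj : ∀ t, ∃ P : E → E, t ∈ Icc 0 T → (∀ x, P x ∈ dom (F t)) ∧
      (∀ x, ‖P x - x‖ = Metric.infDist x (dom (F t))) ∧ (∀ x y, ‖P x - P y‖ ≤ ‖x - y‖) ∧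
      ∀ x, Tendsto (fun n : ℕ => resolvent (F t) (1 / ((n : ℝ) + 1)) x) atTop (𝓝 (P x)) := by
    intro t
    by_cases ht : t ∈ Icc 0 T
    · obtain ⟨P, hP⟩ := (hA t ht).tendsto_resolvent_of_isClosed (hcl t ht)
      exact ⟨P, fun _ => hP⟩
    · exact ⟨id, fun h => absurd h ht⟩
  choose P hP using hproj
  set m : ℝ → ℝ := fun t => 1 + |deriv φ t| with hm
  have hmi : IntervalIntegrable m volume 0 T :=
    intervalIntegrable_const.add hφ.intervalIntegrable_deriv.norm
  have hm0 : ∀ t, 0 ≤ m t := fun t => by positivity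
  -- Projections inherit measurability in time as limits of resolvents.
  have hPmeas : ∀ x, AEStronglyMeasurable (fun t => P t x) (volume.restrict (Icc 0 T)) := by
    intro x
    refine aestronglyMeasurable_of_tendsto_ae atTop
      (fun n : ℕ => aestronglyMeasurable_resolvent measurableSet_Icc hA hF x
        (c := fun _ => 1 / ((n : ℝ) + 1)) aemeasurable_const fun _ _ => by positivity) ?_
    rw [ae_restrict_iff' measurableSet_Icc]
    exact Eventually.of_forall fun t ht => (hP t ht).2.2.2 x
  have hmeas : ∀ x, AEStronglyMeasurable (fun t => (m t / ε) • (P t x - x))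
      (volume.restrict (Icc 0 T)) := fun x => by
    refine AEStronglyMeasurable.smul ?_ ((hPmeas x).sub aestronglyMeasurable_const)
    exact ((intervalIntegrable_iff_integrableOn_Icc_of_le hT).1
      (hmi.div_const ε)).aestronglyMeasurable
  -- The curve solves `z' = (m / ε) (P z - z)`. Relaxation keeps `‖P z - z‖ ≤ ε`, so its speed is at
  -- most `m`, whatever `ε` is.
  obtain ⟨z, hzac, hz0, hz⟩ := exists_caratheodory_solution hT
    (H := fun t x => (m t / ε) • (P t x - x)) (κ := fun t => m t / ε * 2) (x₀ := x₀)
    ((hmi.div_const ε).mul_const 2) (fun t _ => mul_nonneg (div_nonneg (hm0 t) hε.le) two_pos.le)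
    (fun t ht x y => by
      rw [← smul_sub, norm_smul, Real.norm_of_nonneg (div_nonneg (hm0 t) hε.le), mul_assoc]
      refine mul_le_mul_of_nonneg_left ?_ (div_nonneg (hm0 t) hε.le)
      have h1 := norm_sub_le (P t x - P t y) (x - y)
      have h2 := (hP t ht).2.2.1 x y
      rw [sub_sub_sub_comm]
      linarith) hmeas (by
    have hd : IntervalIntegrable (fun t => m t / ε * (φ t - φ 0)) volume 0 T :=
      (hmi.div_const ε).mul_continuousOn (hφ.continuousOn.sub continuousOn_const)
    refine hd.mono_fun' ?_ ?_
    · rw [uIoc_of_le hT]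
      exact (hmeas x₀).mono_set Ioc_subset_Icc_self
    · rw [uIoc_of_le hT, EventuallyLE, ae_restrict_iff' measurableSet_Ioc]
      refine Eventually.of_forall fun t ht => ?_
      have htI := Ioc_subset_Icc_self ht
      rw [norm_smul, Real.norm_of_nonneg (div_nonneg (hm0 t) hε.le), (hP t htI).2.1]
      exact mul_le_mul_of_nonneg_left (hex 0 t le_rfl htI.1 htI.2 _ hx₀)
        (div_nonneg (hm0 t) hε.le))
  have hD := infDist_le_of_relaxation (C := fun t => dom (F t)) (u := fun _ => 0)
    (G := fun t => P t (z t)) (g := m)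
    (fun t ht => (hA t ht).convex_dom (hcl t ht)) hcl (fun t ht => (hA t ht).dom_nonempty) hφ hex
    hzac (by rwa [hz0]) hε (fun t ht => (hP t ht).1 _) (fun t _ => by simp [hm]) (by
      filter_upwards [hz] with t ht htT
      simpa using ht htT)
  refine ⟨z, fun t => P t (z t), hzac, hz0, ?_, fun t ht => ⟨(hP t ht).1 _, ?_⟩⟩
  · filter_upwards [hz] with t ht htT
    refine ⟨_, ht htT, ?_⟩
    rw [norm_smul, Real.norm_of_nonneg (div_nonneg (hm0 t) hε.le), (hP t htT).2.1]
    calc _ ≤ m t / ε * ε := mul_le_mul_of_nonneg_left (hD t htT) (div_nonneg (hm0 t) hε.le)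
      _ = m t := by field_simp
  · rw [(hP t ht).2.1]
    exact hD t ht

/-- Solutions of the Yosida approximation with the time-dependent parameter `ε / g t`. -/
theorem exists_yosida_solution (hT : 0 ≤ T) (hA : ∀ t ∈ Icc 0 T, IsMaximalMonotone (F t))
    (hF : OuterSemicontinuousOn (fun t => graph (F t)) (Icc 0 T))
    {g : ℝ → ℝ} {u : ℝ → E} (hg : IntegrableOn g (Icc 0 T)) (hg0 : ∀ t ∈ Icc 0 T, 0 < g t)
    (hu : IntegrableOn u (Icc 0 T)) {x₀ : E} {ε Δ : ℝ} (hε : 0 < ε)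
    (hsel : ∀ t ∈ Icc 0 T, ∃ z, ∃ v ∈ F t z, ‖x₀ - z‖ ≤ Δ ∧ ‖v‖ ≤ g t) :
    ∃ x : ℝ → E, AbsolutelyContinuousOnInterval x 0 T ∧ x 0 = x₀ ∧
      ∀ᵐ t, t ∈ Icc 0 T →
        HasDerivAt x ((g t / ε) • (resolvent (F t) (ε / g t) (x t) - x t) + u t) t := by
  have hgi := (intervalIntegrable_iff_integrableOn_Icc_of_le hT).2 hg
  have hui := (intervalIntegrable_iff_integrableOn_Icc_of_le hT).2 hu
  have hκ0 : ∀ t ∈ Icc 0 T, 0 ≤ g t / ε := fun t ht => div_nonneg (hg0 t ht).le hε.le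
  have hmeas : ∀ x, AEStronglyMeasurable
      (fun t => (g t / ε) • (resolvent (F t) (ε / g t) x - x) + u t)
      (volume.restrict (Icc 0 T)) := fun x => by
    refine AEStronglyMeasurable.add (AEStronglyMeasurable.smul ?_
      (AEStronglyMeasurable.sub ?_ aestronglyMeasurable_const)) hu.aestronglyMeasurable
    · exact (hg.div_const ε).aestronglyMeasurable
    · exact aestronglyMeasurable_resolvent measurableSet_Icc hA hF x
        (hg.aestronglyMeasurable.aemeasurable.const_div ε) fun t ht => div_pos hε (hg0 t ht)
  refine exists_caratheodory_solution hT
    (H := fun t x => (g t / ε) • (resolvent (F t) (ε / g t) x - x) + u t)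
    (κ := fun t => g t / ε * 2) ((hgi.div_const ε).mul_const 2)
    (fun t ht => mul_nonneg (hκ0 t ht) two_pos.le) (fun t ht x y => ?_) hmeas ?_
  · rw [add_sub_add_right_eq_sub, ← smul_sub, norm_smul, Real.norm_of_nonneg (hκ0 t ht),
      mul_assoc]
    refine mul_le_mul_of_nonneg_left ?_ (hκ0 t ht)
    have h1 := norm_sub_le (resolvent (F t) (ε / g t) x - resolvent (F t) (ε / g t) y) (x - y)
    have h2 := (hA t ht).norm_resolvent_sub_le (div_pos hε (hg0 t ht)) x y
    rw [sub_sub_sub_comm]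
    linarith
  · have hd : IntervalIntegrable (fun t => g t / ε * (ε + 2 * Δ) + ‖u t‖) volume 0 T :=
      ((hgi.div_const ε).mul_const _).add hui.norm
    refine hd.mono_fun' ?_ ?_
    · rw [uIoc_of_le hT]
      exact (hmeas x₀).mono_set Ioc_subset_Icc_self
    · rw [uIoc_of_le hT, EventuallyLE, ae_restrict_iff' measurableSet_Ioc]
      refine Eventually.of_forall fun t ht => ?_
      have htI := Ioc_subset_Icc_self ht
      refine (norm_add_le _ _).trans (add_le_add_left ?_ _)
      rw [norm_smul, Real.norm_of_nonneg (hκ0 t htI)]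
      refine mul_le_mul_of_nonneg_left ?_ (hκ0 t htI)
      obtain ⟨z, v, hv, hz, hvg⟩ := hsel t htI
      have h1 := (hA t htI).norm_resolvent_sub_self_le (div_pos hε (hg0 t htI)) x₀ hv
      have h2 : ε / g t * ‖v‖ ≤ ε := by
        calc _ ≤ ε / g t * g t :=
              mul_le_mul_of_nonneg_left hvg (div_pos hε (hg0 t htI)).le
          _ = ε := div_mul_cancel₀ _ (hg0 t htI).ne'
      linarith

omit [MeasurableSpace E] [BorelSpace E] in
/-- Comparison of a solution of the Yosida approximation with a curve near the domains. -/
theorem norm_yosida_sub_le (hA : ∀ t ∈ Icc 0 T, IsMaximalMonotone (F t))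
    {g m b : ℝ → ℝ} {u : ℝ → E} {x z P : ℝ → E} {ε δ : ℝ} (hε : 0 < ε) (hδ : 0 ≤ δ)
    (hg : IntervalIntegrable g volume 0 T) (hg0 : ∀ t ∈ Icc 0 T, 0 < g t)
    (hm : IntervalIntegrable m volume 0 T)
    (hm0 : ∀ t ∈ Icc 0 T, 0 ≤ m t) (hb : IntervalIntegrable b volume 0 T)
    (hu : IntervalIntegrable u volume 0 T)
    (hx : AbsolutelyContinuousOnInterval x 0 T) (hz : AbsolutelyContinuousOnInterval z 0 T)
    (hxz : x 0 = z 0)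
    (hxder : ∀ᵐ t, t ∈ Icc 0 T →
      HasDerivAt x ((g t / ε) • (resolvent (F t) (ε / g t) (x t) - x t) + u t) t)
    (hzder : ∀ᵐ t, t ∈ Icc 0 T → ∃ v, HasDerivAt z v t ∧ ‖v‖ ≤ m t)
    (hP : ∀ t ∈ Icc 0 T, ‖P t - z t‖ ≤ δ)
    (hsel : ∀ t ∈ Icc 0 T, ∃ v ∈ F t (P t), ‖v‖ ≤ b t) {t : ℝ} (ht : t ∈ Icc 0 T) :
    ‖x t - z t‖ ≤ (∫ s in (0 : ℝ)..T, (b s + ‖u s‖ + m s)) +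
      2 * δ / ε * ∫ s in (0 : ℝ)..T, g s := by
  have hsub : uIcc 0 t ⊆ uIcc 0 T :=
    uIcc_subset_uIcc left_mem_uIcc (by rw [uIcc_of_le (ht.1.trans ht.2)]; exact ht)
  have hi1 : IntervalIntegrable (fun s => b s + ‖u s‖ + m s) volume 0 T := (hb.add hu.norm).add hm
  have hi2 : IntervalIntegrable (fun s => 2 * δ / ε * g s) volume 0 T := hg.const_mul _
  have hpt : ∀ᵐ s, s ∈ Icc 0 T → 0 ≤ b s + ‖u s‖ + m s + 2 * δ / ε * g s ∧
      ∃ v, HasDerivAt (fun s => x s - z s) v s ∧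
        inner ℝ v (x s - z s) ≤ (b s + ‖u s‖ + m s + 2 * δ / ε * g s) * ‖x s - z s‖ := by
    filter_upwards [hxder, hzder] with s hxs hzs hs
    obtain ⟨v, hv, hvm⟩ := hzs hs
    obtain ⟨w, hw, hwb⟩ := hsel s hs
    have hgs := hg0 s hs
    have hκ : 0 < g s / ε := div_pos hgs hε
    have hc : 0 < ε / g s := div_pos hε hgs
    have hb0 := (norm_nonneg w).trans hwb
    have hms := hm0 s hs
    refine ⟨by positivity, _, (hxs hs).sub hv, ?_⟩
    set κ := g s / ε with hκd
    set Jx := resolvent (F s) (ε / g s) (x s)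
    set Jz := resolvent (F s) (ε / g s) (z s)
    have hne : ‖Jx - Jz‖ ≤ ‖x s - z s‖ := (hA s hs).norm_resolvent_sub_le hc _ _
    -- The first part is dissipative because the resolvent is nonexpansive; the second involves the
    -- Yosida term only at `z`, where the selection at the nearby point `P` bounds it.
    have e : κ • (Jx - x s) + u s - v =
        κ • ((Jx - Jz) - (x s - z s)) + (κ • (Jz - z s) + u s - v) := by module
    have h1 : inner ℝ (κ • ((Jx - Jz) - (x s - z s))) (x s - z s) ≤ 0 := by
      rw [real_inner_smul_left, inner_sub_left, real_inner_self_eq_norm_sq]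
      have := real_inner_le_norm (Jx - Jz) (x s - z s)
      have h2 : ‖Jx - Jz‖ * ‖x s - z s‖ ≤ ‖x s - z s‖ * ‖x s - z s‖ := by gcongr
      exact mul_nonpos_of_nonneg_of_nonpos hκ.le (by linarith)
    have h2 : ‖κ • (Jz - z s) + u s - v‖ ≤ b s + ‖u s‖ + m s + 2 * δ / ε * g s := by
      have h3 := (hA s hs).norm_resolvent_sub_self_le hc (z s) hw
      have h4 := hP s hs
      rw [norm_sub_rev] at h4
      have h5 : κ * ‖Jz - z s‖ ≤ κ * (ε / g s * b s + 2 * δ) := by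
        refine mul_le_mul_of_nonneg_left (h3.trans ?_) hκ.le
        gcongr
      have h6 : κ * (ε / g s * b s + 2 * δ) = b s + 2 * δ / ε * g s := by
        rw [hκd]; field_simp
      have h7 := norm_sub_le (κ • (Jz - z s) + u s) v
      have h8 := norm_add_le (κ • (Jz - z s)) (u s)
      rw [norm_smul, Real.norm_of_nonneg hκ.le] at h8
      linarith
    rw [e, inner_add_left]
    have h3 := real_inner_le_norm (κ • (Jz - z s) + u s - v) (x s - z s)
    have h4 := mul_le_mul_of_nonneg_right h2 (norm_nonneg (x s - z s))
    linarith
  have key := norm_le_add_integral ht.1 ((hx.fun_sub hz).mono hsub)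
    ((hi1.add hi2).mono_set hsub) (by
      filter_upwards [hpt] with s hs hst
      exact hs ⟨hst.1, hst.2.trans ht.2⟩)
  have hnn : ∀ s ∈ Icc 0 T, 0 ≤ b s + ‖u s‖ + m s + 2 * δ / ε * g s := fun s hs => by
    obtain ⟨w, -, hwb⟩ := hsel s hs
    have hb0 := (norm_nonneg w).trans hwb
    have hgs := hg0 s hs
    have hms := hm0 s hs
    positivity
  have h1 := intervalIntegral_mono_right_of_nonneg (hi1.add hi2) hnn ht
  rw [intervalIntegral.integral_add hi1 hi2, intervalIntegral.integral_const_mul] at h1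
  rw [hxz, sub_self, norm_zero, zero_add] at key
  exact key.trans h1

end Approximation

/-! ### A priori bounds, existence and uniqueness. -/

section Existence

variable {E : Type*} [NormedAddCommGroup E] [InnerProductSpace ℝ E] [FiniteDimensional ℝ E]

theorem MinimalSectionGrowth.exists_bounded_selection {T : ℝ} {F : ℝ → E → Set E}
    (h : MinimalSectionGrowth T F) (hA : ∀ t ∈ Icc 0 T, IsMaximalMonotone (F t)) {r : ℝ}
    (hr : 0 < r) : ∃ σ : ℝ → ℝ, IntegrableOn σ (Icc 0 T) ∧ ∀ t ∈ Icc 0 T, 0 ≤ σ t ∧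
      ∀ x ∈ dom (F t), ‖x‖ ≤ r → ∃ v ∈ F t x, ‖v‖ ≤ σ t := by
  obtain ⟨σ, hσ, hσ0, hle⟩ := h r hr
  refine ⟨fun t => σ t * (1 + r), hσ.mul_const _, fun t ht =>
    ⟨mul_nonneg (hσ0 t ht) (by positivity), fun x hx hxr => ⟨_, (hA t ht).minimalSection_mem hx,
      (hle t ht x ⟨mem_closedBall_zero_iff.2 hxr, hx⟩).trans ?_⟩⟩⟩
  exact mul_le_mul_of_nonneg_left (by linarith) (hσ0 t ht)

omit [InnerProductSpace ℝ E] [FiniteDimensional ℝ E] in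
theorem infDist_le_of_iSup_infEDist_le {C D : Set E} {c : ℝ}
    (h : ⨆ z ∈ C, Metric.infEDist z D ≤ ENNReal.ofReal c) (hc : 0 ≤ c) {z : E} (hz : z ∈ C) :
    Metric.infDist z D ≤ c :=
  ENNReal.toReal_le_of_le_ofReal hc ((le_iSup₂ (f := fun z _ => Metric.infEDist z D) z hz).trans h)

variable [MeasurableSpace E] [BorelSpace E]

/-- The order of choices matters: the tracking bound `B` depends only on `φ` and `T`; it fixes `b`,
then `I`, the radius for `s`, and finally `g`. The tracking accuracy `δ` comes last, after `ε` and
`g`. -/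
theorem exists_isApproxSolution {T : ℝ} (hT : 0 ≤ T) {F : ℝ → E → Set E} {φ : ℝ → ℝ}
    (hA : ∀ t ∈ Icc 0 T, IsMaximalMonotone (F t))
    (hF : OuterSemicontinuousOn (fun t => graph (F t)) (Icc 0 T))
    (hcl : ∀ t ∈ Icc 0 T, IsClosed (dom (F t))) (hφ : AbsolutelyContinuousOnInterval φ 0 T)
    (hφm : MonotoneOn φ (Icc 0 T))
    (hex : ∀ s t, 0 ≤ s → s ≤ t → t ≤ T → ∀ z ∈ dom (F s),
      Metric.infDist z (dom (F t)) ≤ φ t - φ s)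
    (hgrow : MinimalSectionGrowth T F) {u : ℝ → E} (hu : IntegrableOn u (Icc 0 T))
    {x₀ : E} (hx₀ : x₀ ∈ dom (F 0)) :
    ∃ g : ℝ → ℝ, IntegrableOn g (Icc 0 T) ∧ (∀ t ∈ Icc 0 T, ‖u t‖ ≤ g t) ∧
      ∀ ε, 0 < ε → ε ≤ 1 → ∃ x J w : ℝ → E, IsApproxSolution T F u g x₀ (3 * ε) x J w := by
  have hiff : ∀ f : ℝ → ℝ, IntegrableOn f (Icc 0 T) ↔ IntervalIntegrable f volume 0 T := fun f =>
    (intervalIntegrable_iff_integrableOn_Icc_of_le hT).symm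
  have hui := (intervalIntegrable_iff_integrableOn_Icc_of_le hT).2 hu
  set m : ℝ → ℝ := fun t => 1 + |deriv φ t| with hm
  have hmi : IntervalIntegrable m volume 0 T :=
    intervalIntegrable_const.add hφ.intervalIntegrable_deriv.norm
  have hm0 : ∀ t ∈ Icc 0 T, 0 ≤ m t := fun t _ => by positivity
  set B := ∫ t in (0 : ℝ)..T, m t with hB
  have hB0 : 0 ≤ B := intervalIntegral.integral_nonneg hT hm0
  obtain ⟨b, hb, hbsel⟩ := hgrow.exists_bounded_selection hA
    (r := ‖x₀‖ + B + 1) (by positivity)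
  set I := ∫ t in (0 : ℝ)..T, (b t + ‖u t‖ + m t) with hI
  have hI0 : 0 ≤ I := intervalIntegral.integral_nonneg hT fun t ht =>
    add_nonneg (add_nonneg (hbsel t ht).1 (norm_nonneg _)) (hm0 t ht)
  have h0T : (0 : ℝ) ∈ Icc 0 T := ⟨le_rfl, hT⟩
  set Δ := φ T - φ 0 with hΔ
  have hΔ0 : 0 ≤ Δ := sub_nonneg.2 (hφm h0T ⟨hT, le_rfl⟩ hT)
  -- This radius covers the points of the domains nearest to `x₀` (within `Δ`) and nearest to `x t`
  -- (within `ε ≤ 1` of a curve of norm at most `‖x₀‖ + B + I + 1`).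
  obtain ⟨s, hs, hssel⟩ := hgrow.exists_bounded_selection hA
    (r := ‖x₀‖ + B + I + 2 + Δ) (by positivity)
  set g : ℝ → ℝ := fun t => m t + s t + ‖u t‖ with hg
  have hgi : IntegrableOn g (Icc 0 T) := (((hiff m).2 hmi).add hs).add hu.norm
  have hg0 : ∀ t ∈ Icc 0 T, 0 < g t := fun t ht => by
    have := (hssel t ht).1
    positivity
  have hsg : ∀ t ∈ Icc 0 T, s t ≤ g t := fun t ht => by
    have := hm0 t ht
    have := norm_nonneg (u t)
    simp only [hg]
    linarith
  have hug : ∀ t ∈ Icc 0 T, ‖u t‖ + |deriv φ t| ≤ g t := fun t ht => by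
    have := (hssel t ht).1
    simp only [hg, hm]
    linarith
  have hgi' := (hiff g).1 hgi
  set Γ := ∫ t in (0 : ℝ)..T, g t with hΓ
  have hΓ0 : 0 ≤ Γ := intervalIntegral.integral_nonneg hT fun t ht => (hg0 t ht).le
  -- The factor `3` arises since the Yosida term is `g t / ε` times a displacement of at most `3 *
  -- ε`.
  refine ⟨fun t => 3 * g t, hgi.const_mul 3, fun t ht => ?_, fun ε hε hε1 => ?_⟩
  · have := hug t ht
    have := abs_nonneg (deriv φ t)
    have := hg0 t ht
    linarith
  obtain ⟨x, hxac, hx0, hxder⟩ := exists_yosida_solution hT hA hF hgi hg0 hu (x₀ := x₀) (Δ := Δ) hε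
    (fun t ht => by
      obtain ⟨z, hz, hd⟩ := (hcl t ht).exists_infDist_eq_dist (hA t ht).dom_nonempty x₀
      have h1 : ‖x₀ - z‖ ≤ Δ := by
        rw [← dist_eq_norm, ← hd]
        refine (hex 0 t le_rfl ht.1 ht.2 _ hx₀).trans ?_
        have := hφm ht ⟨hT, le_rfl⟩ ht.2
        linarith
      have h2 := norm_sub_norm_le z x₀
      rw [norm_sub_rev] at h2
      obtain ⟨v, hv, hvs⟩ := (hssel t ht).2 z hz (by linarith)
      exact ⟨z, v, hv, h1, hvs.trans (hsg t ht)⟩)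
  have hD := infDist_le_of_relaxation (C := fun t => dom (F t)) (u := u)
    (G := fun t => resolvent (F t) (ε / g t) (x t)) (g := g)
    (fun t ht => (hA t ht).convex_dom (hcl t ht)) hcl (fun t ht => (hA t ht).dom_nonempty) hφ hex
    hxac (by rwa [hx0]) hε (fun t ht => (hA t ht).resolvent_mem_dom (div_pos hε (hg0 t ht)) _)
    hug hxder
  -- This makes the comparison error `2 * δ / ε * Γ` at most `1` and keeps `P t` in the ball on
  -- which `b` is valid.
  set δ := min 1 (ε / (2 * (Γ + 1))) with hδ
  have hδ0 : 0 < δ := lt_min one_pos (by positivity)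
  obtain ⟨z, P, hzac, hz0, hzder, hP⟩ := exists_domain_tracking hT hA hF hcl hφ hex hx₀ hδ0
  have hzB : ∀ t ∈ Icc 0 T, ‖z t‖ ≤ ‖x₀‖ + B := fun t ht => by
    have hsub : uIcc 0 t ⊆ uIcc 0 T :=
      uIcc_subset_uIcc left_mem_uIcc (by rwa [uIcc_of_le hT])
    have h1 := norm_sub_le_integral ht.1 (hzac.mono hsub) (hmi.mono_set hsub) (by
      filter_upwards [hzder] with r hr hrt
      exact hr ⟨hrt.1, hrt.2.trans ht.2⟩)
    have h2 := intervalIntegral_mono_right_of_nonneg hmi hm0 ht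
    have h3 := norm_sub_norm_le (z t) (z 0)
    rw [hz0] at h1 h3
    linarith
  have hxB : ∀ t ∈ Icc 0 T, ‖x t‖ ≤ ‖x₀‖ + B + I + 1 := fun t ht => by
    have h1 := norm_yosida_sub_le hA hε hδ0.le hgi' hg0 hmi hm0 ((hiff b).1 hb) hui hxac hzac
      (hx0.trans hz0.symm) hxder hzder (fun t ht => (hP t ht).2) (fun t ht => by
        refine (hbsel t ht).2 _ (hP t ht).1 ?_
        have h2 := norm_sub_norm_le (P t) (z t)
        have h3 := (hP t ht).2
        have h4 := hzB t ht
        have h5 : δ ≤ 1 := min_le_left _ _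
        linarith) ht
    have h2 : 2 * δ / ε * Γ ≤ 1 := by
      have h3 : δ * (2 * (Γ + 1)) ≤ ε := (le_div_iff₀ (by positivity)).1 (min_le_right _ _)
      rw [div_mul_eq_mul_div, div_le_one hε]
      linarith
    have h3 := norm_sub_norm_le (x t) (z t)
    have h4 := hzB t ht
    linarith
  -- One `ε` comes from the selection at the nearest point `p`, as `ε / g t * ‖v‖ ≤ ε`, and two from
  -- `2 * ‖x t - p‖`.
  have hJ : ∀ t ∈ Icc 0 T, ‖resolvent (F t) (ε / g t) (x t) - x t‖ ≤ 3 * ε := fun t ht => by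
    obtain ⟨p, hp, hd⟩ := (hcl t ht).exists_infDist_eq_dist (hA t ht).dom_nonempty (x t)
    have h1 : ‖x t - p‖ ≤ ε := by
      rw [← dist_eq_norm, ← hd]
      exact hD t ht
    have h2 := norm_sub_norm_le p (x t)
    rw [norm_sub_rev] at h2
    obtain ⟨v, hv, hvs⟩ := (hssel t ht).2 p hp (by linarith [hxB t ht])
    have h3 := (hA t ht).norm_resolvent_sub_self_le (div_pos hε (hg0 t ht)) (x t) hv
    have h4 : ε / g t * ‖v‖ ≤ ε := by
      calc _ ≤ ε / g t * g t :=
            mul_le_mul_of_nonneg_left (hvs.trans (hsg t ht)) (div_pos hε (hg0 t ht)).le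
        _ = ε := div_mul_cancel₀ _ (hg0 t ht).ne'
    linarith
  refine ⟨x, fun t => resolvent (F t) (ε / g t) (x t),
    fun t => (ε / g t)⁻¹ • (x t - resolvent (F t) (ε / g t) (x t)), hxac, hx0,
    fun t ht => (hA t ht).resolvent_spec (div_pos hε (hg0 t ht)) _, hJ, fun t ht => ?_, ?_⟩
  · have := hg0 t ht
    rw [norm_smul, norm_sub_rev, inv_div, Real.norm_of_nonneg (div_nonneg this.le hε.le)]
    calc _ ≤ g t / ε * (3 * ε) := by gcongr; exact hJ t ht
      _ = 3 * g t := by field_simp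
  · filter_upwards [hxder] with t ht htT
    rw [inv_div, ← smul_neg, neg_sub]
    exact ht htT

omit [FiniteDimensional ℝ E] [MeasurableSpace E] [BorelSpace E] in
theorem IsSolution.eqOn {T : ℝ} {F : ℝ → E → Set E} {u : ℝ → E} {x₀ : E} {x y : ℝ → E}
    (hF : ∀ t ∈ Icc 0 T, IsMonotone (F t)) (hx : IsSolution T F u x₀ x)
    (hy : IsSolution T F u x₀ y) : EqOn y x (Icc 0 T) := by
  intro t ht
  obtain ⟨hxac, hx0, hx⟩ := hx
  obtain ⟨hyac, hy0, hy⟩ := hy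
  rw [ae_restrict_iff' measurableSet_Icc] at hx hy
  have hsub : uIcc 0 t ⊆ uIcc 0 T :=
    uIcc_subset_uIcc left_mem_uIcc (by rw [uIcc_of_le (ht.1.trans ht.2)]; exact ht)
  have key := norm_sq_le_add_integral (m := fun _ => 0) ht.1 ((hyac.fun_sub hxac).mono hsub)
    (by simp) (by
      filter_upwards [hx, hy] with s hxs hys hst
      have hsT : s ∈ Icc 0 T := ⟨hst.1, hst.2.trans ht.2⟩
      obtain ⟨-, v, hv, w, hw, rfl⟩ := hxs hsT
      obtain ⟨-, v', hv', w', hw', rfl⟩ := hys hsT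
      refine ⟨_, hv'.sub hv, ?_⟩
      have hmon := hF s hsT _ _ _ _ hw' hw
      have e : -w' + u s - (-w + u s) = -(w' - w) := by abel
      rw [e, inner_neg_left, real_inner_comm]
      linarith)
  simp only [hx0, hy0, sub_self, norm_zero, intervalIntegral.integral_zero] at key
  have : ‖y t - x t‖ = 0 := by
    have := sq_nonneg ‖y t - x t‖
    exact pow_eq_zero_iff two_ne_zero |>.1 (by linarith)
  exact sub_eq_zero.1 (norm_eq_zero.1 this)

theorem exists_isSolution {T : ℝ} (hT : 0 ≤ T) {F : ℝ → E → Set E}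
    (hA : ∀ t ∈ Icc 0 T, IsMaximalMonotone (F t)) (hdom : DomainsMoveAbsCont T F)
    (hgrow : MinimalSectionGrowth T F)
    (hF : OuterSemicontinuousOn (fun t => graph (F t)) (Icc 0 T))
    {u : ℝ → E} (hu : IntegrableOn u (Icc 0 T)) {x₀ : E} (hx₀ : x₀ ∈ closure (dom (F 0))) :
    ∃ x : ℝ → E, IsSolution T F u x₀ x := by
  obtain ⟨φ, hφm, hφ, hexc⟩ := hdom
  -- The growth condition gives a locally bounded selection, so the domains are closed and `x₀` lies
  -- in `dom (F 0)` itself.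
  have hcl : ∀ t ∈ Icc 0 T, IsClosed (dom (F t)) := fun t ht =>
    (hA t ht).isClosed_dom fun r hr => by
      obtain ⟨σ, -, hσ⟩ := hgrow.exists_bounded_selection hA hr
      exact ⟨σ t, (hσ t ht).2⟩
  have hex : ∀ s t, 0 ≤ s → s ≤ t → t ≤ T → ∀ z ∈ dom (F s),
      Metric.infDist z (dom (F t)) ≤ φ t - φ s := fun s t hs hst ht z hz =>
    infDist_le_of_iSup_infEDist_le (hexc s t hs hst ht)
      (sub_nonneg.2 (hφm ⟨hs, hst.trans ht⟩ ⟨hs.trans hst, ht⟩ hst)) hz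
  rw [(hcl 0 ⟨le_rfl, hT⟩).closure_eq] at hx₀
  obtain ⟨g, hg, hug, happ⟩ := exists_isApproxSolution hT hA hF hcl hφ hφm hex hgrow hu hx₀
  choose x J w h using fun n : ℕ => happ (1 / ((n : ℝ) + 1)) (by positivity)
    (by rw [div_le_one (by positivity)]; linarith [n.cast_nonneg (α := ℝ)])
  obtain ⟨y, hyac, hy0, hy⟩ := exists_solution_of_approx hT hA
    ((intervalIntegrable_iff_integrableOn_Icc_of_le hT).2 hg) hug (fun n => by positivity)
    (by simpa using tendsto_one_div_add_atTop_nhds_zero_nat.const_mul (3 : ℝ)) h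
  refine ⟨y, hyac, hy0, ?_⟩
  rw [ae_restrict_iff' measurableSet_Icc]
  filter_upwards [hy] with t ht htT
  obtain ⟨v, hv, hmem⟩ := ht htT
  exact ⟨⟨_, hmem⟩, v, hv, _, hmem, by abel⟩

end Existence

end EvolInclusion

theorem theoremt (n : ℕ) (T : ℝ) (hT : 0 < T)
    (F : ℝ → EuclideanSpace ℝ (Fin n) → Set (EuclideanSpace ℝ (Fin n)))
    (hA1 : ∀ t ∈ Set.Icc 0 T, EvolInclusion.IsMaximalMonotone (F t))
    (hA2 : EvolInclusion.DomainsMoveAbsCont T F)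
    (hA3 : EvolInclusion.MinimalSectionGrowth T F)
    (hA4 : EvolInclusion.OuterSemicontinuousOn
      (fun t => EvolInclusion.graph (F t)) (Set.Icc 0 T))
    (u : ℝ → EuclideanSpace ℝ (Fin n))
    (hu : MeasureTheory.IntegrableOn u (Set.Icc 0 T))
    (x₀ : EuclideanSpace ℝ (Fin n))
    (hx₀ : x₀ ∈ closure (EvolInclusion.dom (F 0))) :
    ∃ x : ℝ → EuclideanSpace ℝ (Fin n), EvolInclusion.IsSolution T F u x₀ x ∧
      ∀ y : ℝ → EuclideanSpace ℝ (Fin n), EvolInclusion.IsSolution T F u x₀ y →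
        Set.EqOn y x (Set.Icc 0 T) := by
  obtain ⟨x, hx⟩ := EvolInclusion.exists_isSolution hT.le hA1 hA2 hA3 hA4 hu hx₀
  exact ⟨x, hx, fun y hy => hx.eqOn (fun t ht => (hA1 t ht).1) hy⟩
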